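/- Let $p_1=0$, $p_2=1$, $p_3=e^{\pi i/3}$ in $\mathbb{C}$, let $F_i(x)=\frac12(x-p_i)+p_i$ ($i=1,2,3$), and let $K$ be the Sierpiński gasket, the unique nonempty compact set with $K=\bigcup_{i=1}^3F_i(K)$. For $\omega=(\omega_1,\dots,\omega_n)\in W_n=\{1,2,3\}^n$ put $F_\omega=F_{\omega_1}\circ\cdots\circ F_{\omega_n}$ and $u_\omega=u\circ F_\omega$. Let $V_0=\{p_1,p_2,p_3\}$, $V_{n}=\bigcup_{i}F_i(V_{n-1})$, and write $p\sim_nq$ if $p\neq q$ and $p,q\in F_\omega(V_0)$ for some $\omega\in W_n$. For $a,b,c>0$ let $$\mathcal E_n^{[a,b,c]}(u)=\sum_{\omega\in W_n}\Big(a\,(u_\omega(p_2)-u_\omega(p_3))^2+b\,(u_\omega(p_3)-u_\omega(p_1))^2+c\,(u_\omega(p_1)-u_\omega(p_2))^2\Big).$$ A recursive construction with initial data $(a_0,b_0,c_0)$, where $a_0,b_0,c_0>0$, is a sequence $(a_n,b_n,c_n)_{n\ge0}$ of triples of positive numbers which starts with $(a_0,b_0,c_0)$ and is compatible: with $\mathcal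 E_n:=\mathcal E_n^{[a_n,b_n,c_n]}$, for all $n\ge0$ and all $v:V_n\to\mathbb R$, $$\mathcal E_n(v)=\min\{\mathcal E_{n+1}(u):\ u:V_{n+1}\to\mathbb R,\ u|_{V_n}=v\}.$$ **Corollary 2.4.** Let $a_0,b_0,c_0>0$. A recursive construction with initial data $(a_0,b_0,c_0)$ exists if and only if either (i) $a_0=b_0=c_0$, or (ii) $a_0>b_0=c_0$ or one of the symmetric alternatives $b_0>c_0=a_0$, $c_0>a_0=b_0$ holds; it is then unique, and the limit $\mathcal E(u):=\lim_{n\to\infty}\mathcal E_n(u)\in[0,\infty]$ exists for every $u:K\to\mathbb R$ (in particular for every $u\in C(K)$). Moreover: (i) If $a_0=b_0=c_0$, then $\mathcal E$ is, up to the constant factor $a_0$, the standard Dirichlet form on the Sierpiński gasket: for every $u:K\to\mathbb R$ the limit $$\mathcal E_{\rm std}(u)=\lim_{n\to\infty}\Big(\frac53\Big)^n\sum_{p\sim_nq}(u(p)-u(q))^2\in[0,\infty]$$ (each edge counted once) exists and $\mathcal E(u)=a_0\,\mathcal E_{\rm std}(u)$; and the domains $\{u\in C(K):\mathcal E(u)<\infty\}$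 and $\{u\in C(K):\mathcal E_{\rm std}(u)<\infty\}$ coincide. (ii) If $a_0>b_0=c_0$, then there is a constant $C>0$, depending only on $(a_0,b_0,c_0)$, such that for every $u:K\to\mathbb R$ we have $\mathcal E(u)\le C\,S(u)$ and $S(u)\le C\,\mathcal E(u)$ in $[0,\infty]$, where $$S(u)=\sup_{n\ge0}\ 2^n\sum_{\omega\in W_n}\Big((u_\omega(p_2)-u_\omega(p_3))^2+\Big(\frac34\Big)^n(u_\omega(p_1)-u_\omega(p_2))^2+\Big(\frac34\Big)^n(u_\omega(p_1)-u_\omega(p_3))^2\Big).$$ In the symmetric alternatives the same holds with the roles of the three vertices permuted accordingly. -/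

import Mathlib

open Set Filter Topology
open scoped ENNReal

namespace Gasket

noncomputable section

/-- The corners of the triangle; the indices `0, 1, 2` stand for `p₁ = 0`, `p₂ = 1`,
`p₃ = exp (π i / 3)` of the usual numbering. -/
def corner : Fin 3 → ℂ := ![0, 1, Complex.exp (Real.pi * Complex.I / 3)]

/-- The similitude `F_i (x) = (x - p_i) / 2 + p_i`. -/
def contr (i : Fin 3) (x : ℂ) : ℂ := (1 / 2) * (x - corner i) + corner i

/-- `K` is a nonempty compact set invariant under the iterated function system. -/
def IsAttractor (K : Set ℂ) : Prop :=
  K.Nonempty ∧ IsCompact K ∧ K = ⋃ i, contr i '' K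

lemma contr_eq (i : Fin 3) (x : ℂ) : contr i x = (x + corner i) / 2 := by
  unfold contr; ring

lemma continuous_contr (i : Fin 3) : Continuous (contr i) := by
  unfold contr; fun_prop

lemma dist_contr (i : Fin 3) (x y : ℂ) : dist (contr i x) (contr i y) = dist x y / 2 := by
  rw [contr_eq, contr_eq, dist_eq_norm, dist_eq_norm,
    show (x + corner i) / 2 - (y + corner i) / 2 = (x - y) / 2 by ring, norm_div]
  norm_num

lemma norm_corner_le (i : Fin 3) : ‖corner i‖ ≤ 1 := by
  fin_cases i
  · simp [corner]
  · simp [corner]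
  · have h : (Real.pi * Complex.I / 3 : ℂ) = ((Real.pi / 3 : ℝ) : ℂ) * Complex.I := by
      push_cast; ring
    have h' : corner 2 = Complex.exp (((Real.pi / 3 : ℝ) : ℂ) * Complex.I) := by
      rw [← h]; rfl
    exact (h' ▸ Complex.norm_exp_ofReal_mul_I (Real.pi / 3)).le

/-- Any attractor is contained in any other one. -/
lemma IsAttractor.subset {K L : Set ℂ} (hK : IsAttractor K) (hL : IsAttractor L) : K ⊆ L := by
  obtain ⟨D, hD⟩ := (hK.2.1.isBounded.union hL.2.1.isBounded).exists_norm_le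
  have key : ∀ n : ℕ, ∀ x ∈ K, ∃ y ∈ L, dist x y ≤ (D + D) / 2 ^ n := by
    intro n
    induction n with
    | zero =>
      intro x hx
      obtain ⟨y, hy⟩ := hL.1
      refine ⟨y, hy, ?_⟩
      rw [dist_eq_norm]
      have h1 := hD x (Or.inl hx)
      have h2 := hD y (Or.inr hy)
      have := norm_sub_le x y
      simp only [pow_zero, div_one]
      linarith
    | succ n ih =>
      intro x hx
      rw [hK.2.2] at hx
      obtain ⟨i, z, hz, rfl⟩ := mem_iUnion.1 hx
      obtain ⟨y, hy, hzy⟩ := ih z hz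
      refine ⟨contr i y, ?_, ?_⟩
      · rw [hL.2.2]; exact mem_iUnion.2 ⟨i, y, hy, rfl⟩
      · rw [dist_contr, pow_succ, ← div_div]; linarith
  intro x hx
  rw [← hL.2.1.isClosed.closure_eq, Metric.mem_closure_iff]
  intro ε hε
  have ht : Tendsto (fun n : ℕ => (D + D) / 2 ^ n) atTop (𝓝 0) := by
    have := (tendsto_pow_atTop_nhds_zero_of_lt_one (r := (1 / 2 : ℝ))
      (by norm_num) (by norm_num)).const_mul (D + D)
    simpa [div_eq_mul_inv] using this
  obtain ⟨n, hn⟩ := (ht.eventually (gt_mem_nhds hε)).exists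
  obtain ⟨y, hy, hxy⟩ := key n x hx
  exact ⟨y, hy, hxy.trans_lt hn⟩

/-- The union of the images of the unit disc under all words of length `n`. -/
def approx : ℕ → Set ℂ
  | 0 => Metric.closedBall 0 1
  | n + 1 => ⋃ i, contr i '' approx n

lemma isCompact_approx (n : ℕ) : IsCompact (approx n) := by
  induction n with
  | zero => exact isCompact_closedBall _ _
  | succ n ih => exact isCompact_iUnion fun i => ih.image (continuous_contr i)

lemma corner_mem_approx (n : ℕ) (i : Fin 3) : corner i ∈ approx n := by
  induction n with
  | zero => simpa [approx] using norm_corner_le i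
  | succ n ih => exact mem_iUnion.2 ⟨i, corner i, ih, by simp [contr]⟩

lemma approx_succ_subset (n : ℕ) : approx (n + 1) ⊆ approx n := by
  induction n with
  | zero =>
    intro x hx
    obtain ⟨i, z, hz, rfl⟩ := mem_iUnion.1 hx
    have hz' : ‖z‖ ≤ 1 := by simpa [approx] using hz
    have : ‖contr i z‖ ≤ 1 := by
      rw [contr_eq, norm_div]
      have h1 := norm_add_le z (corner i)
      have h2 := norm_corner_le i
      norm_num
      linarith
    simpa [approx] using this
  | succ n ih => exact iUnion_mono fun i => image_mono ih

/-- The system has exactly one nonempty compact invariant set. -/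
theorem existsUnique_attractor : ∃! K : Set ℂ, IsAttractor K := by
  have hanti : Antitone approx := antitone_nat_of_succ_le approx_succ_subset
  have hK : IsAttractor (⋂ n, approx n) := by
    refine ⟨⟨corner 0, mem_iInter.2 fun n => corner_mem_approx n 0⟩, ?_, ?_⟩
    · exact (isCompact_approx 0).of_isClosed_subset
        (isClosed_iInter fun n => (isCompact_approx n).isClosed) (iInter_subset _ 0)
    · ext x
      constructor
      · intro hx
        have h1 : ∀ n, ∃ i, 2 * x - corner i ∈ approx n := by
          intro n
          obtain ⟨i, z, hz, hzx⟩ := mem_iUnion.1 (mem_iInter.1 hx (n + 1))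
          refine ⟨i, ?_⟩
          rw [← hzx, contr_eq]
          convert hz using 1
          ring
        have h2 : ∃ i, ∀ n, 2 * x - corner i ∈ approx n := by
          by_contra hcon
          push Not at hcon
          choose N hN using hcon
          obtain ⟨i, hi⟩ := h1 (Finset.univ.sup N)
          exact hN i (hanti (Finset.le_sup (Finset.mem_univ i)) hi)
        obtain ⟨i, hi⟩ := h2
        refine mem_iUnion.2 ⟨i, 2 * x - corner i, mem_iInter.2 hi, ?_⟩
        rw [contr_eq]; ring
      · intro hx
        obtain ⟨i, z, hz, rfl⟩ := mem_iUnion.1 hx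
        refine mem_iInter.2 fun n => approx_succ_subset n ?_
        exact mem_iUnion.2 ⟨i, z, mem_iInter.1 hz n, rfl⟩
  exact ⟨_, hK, fun L hL => (hL.subset hK).antisymm (hK.subset hL)⟩

/-- The Sierpinski gasket: the unique nonempty compact set `K` with `K = ⋃ i, F_i (K)`. -/
def gasket : Set ℂ := existsUnique_attractor.choose

theorem isAttractor_gasket : IsAttractor gasket := existsUnique_attractor.choose_spec.1

lemma contr_mem_gasket (i : Fin 3) {x : ℂ} (hx : x ∈ gasket) : contr i x ∈ gasket := by
  rw [isAttractor_gasket.2.2]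
  exact mem_iUnion.2 ⟨i, x, hx, rfl⟩

lemma corner_mem_gasket (i : Fin 3) : corner i ∈ gasket := by
  obtain ⟨x, hx⟩ := isAttractor_gasket.1
  have hmem : ∀ n : ℕ, corner i + (1 / 2 : ℂ) ^ n * (x - corner i) ∈ gasket := by
    intro n
    induction n with
    | zero => simpa using hx
    | succ n ih =>
      have := contr_mem_gasket i ih
      convert this using 1
      rw [contr_eq, pow_succ]; ring
  have ht : Tendsto (fun n : ℕ => corner i + (1 / 2 : ℂ) ^ n * (x - corner i)) atTop
      (𝓝 (corner i + 0 * (x - corner i))) :=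
    ((tendsto_pow_atTop_nhds_zero_of_norm_lt_one (by norm_num)).mul_const _).const_add _
  have := isAttractor_gasket.2.1.isClosed.mem_of_tendsto ht (Eventually.of_forall hmem)
  simpa using this

/-- The gasket as a topological space (with the topology of the plane). -/
abbrev SG : Type := gasket

/-- The corners as points of the gasket. -/
def vert (i : Fin 3) : SG := ⟨corner i, corner_mem_gasket i⟩

/-- `F_i` as a self-map of the gasket. -/
def cellMap (i : Fin 3) (x : SG) : SG := ⟨contr i x, contr_mem_gasket i x.2⟩

/-- `F_ω = F_{ω₁} ∘ ⋯ ∘ F_{ω_n}` for a word `ω` of length `n` in three letters. -/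
def wordMap : (n : ℕ) → (Fin n → Fin 3) → SG → SG
  | 0, _ => id
  | n + 1, ω => cellMap (ω 0) ∘ wordMap n (Fin.tail ω)

/-- The vertex set `V_n`: `V_0` consists of the corners, `V_{n+1} = ⋃ i, F_i (V_n)`. -/
def vertices : ℕ → Set SG
  | 0 => range vert
  | n + 1 => ⋃ i, cellMap i '' vertices n

/-- The graph `Γ_n`: two distinct points are adjacent when both lie in `F_ω (V_0)` for a common
word `ω` of length `n`. -/
def levelGraph (n : ℕ) : SimpleGraph SG where
  Adj p q := p ≠ q ∧ ∃ ω : Fin n → Fin 3,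
    p ∈ wordMap n ω '' vertices 0 ∧ q ∈ wordMap n ω '' vertices 0
  symm := ⟨fun _ _ h => ⟨h.1.symm, h.2.imp fun _ h' => ⟨h'.2, h'.1⟩⟩⟩
  loopless := ⟨fun _ h => h.1 rfl⟩

/-- `(u p - u q) ^ 2` as a function of the edge `{p, q}`. -/
def edgeSq (u : SG → ℝ) : Sym2 SG → ℝ :=
  Sym2.lift ⟨fun p q => (u p - u q) ^ 2, fun p q => by ring⟩

/-- The renormalized graph energy `(5/3)^n ∑_{p ∼_n q} (u p - u q)^2`, every edge counted once. -/
def stdLevelEnergy (n : ℕ) (u : SG → ℝ) : ℝ :=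
  (5 / 3) ^ n * ∑ᶠ e ∈ (levelGraph n).edgeSet, edgeSq u e

/-- The standard energy on the gasket, with values in `[0, ∞]`. -/
def stdEnergy (u : SG → ℝ) : ℝ≥0∞ :=
  limUnder atTop fun n => ENNReal.ofReal (stdLevelEnergy n u)

/-- The squared increment of `u` along the edge of the cell `F_ω (V_0)` that is opposite to the
vertex `F_ω (p_i)`. -/
def cellDiffSq (u : SG → ℝ) {n : ℕ} (ω : Fin n → Fin 3) (i : Fin 3) : ℝ :=
  (u (wordMap n ω (vert (i + 1))) - u (wordMap n ω (vert (i + 2)))) ^ 2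

/-- The energy on `Γ_n` in which every cell `F_ω (V_0)` of level `n` carries the same three
conductances: `c i` on the edge opposite to `F_ω (p_i)`. -/
def levelEnergy (n : ℕ) (c : Fin 3 → ℝ) (u : SG → ℝ) : ℝ :=
  ∑ ω : Fin n → Fin 3, ∑ i, c i * cellDiffSq u ω i

/-- The sequence `c` of conductances is a recursive construction with initial data `c₀`: all
conductances are positive, and the energies are compatible, that is, the restriction (trace) to
`V_n` of the energy of level `n + 1` is the energy of level `n`. The trace assigns to a function
`v` on `V_n` the least energy of its extensions; functions on `V_n` are written as functions
on the gasket, of which only the values on `V_n` matter. -/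
structure IsRecursiveConstruction (c₀ : Fin 3 → ℝ) (c : ℕ → Fin 3 → ℝ) : Prop where
  init : c 0 = c₀
  pos : ∀ n i, 0 < c n i
  compatible : ∀ (n : ℕ) (v : SG → ℝ),
    IsLeast
      {t : ℝ | ∃ u : SG → ℝ, EqOn u v (vertices n) ∧ t = levelEnergy (n + 1) (c (n + 1)) u}
      (levelEnergy n (c n) v)

/-- The limit energy of a sequence of conductances, with values in `[0, ∞]`. -/
def energy (c : ℕ → Fin 3 → ℝ) (u : SG → ℝ) : ℝ≥0∞ :=
  limUnder atTop fun n => ENNReal.ofReal (levelEnergy n (c n) u)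

/-- The domain `{u ∈ C(K) : E (u) < ∞}` of an energy. -/
def domain (E : (SG → ℝ) → ℝ≥0∞) : Set C(SG, ℝ) := {u | E u < ∞}

/-- The quantity `2^n ∑_ω (D_i + (3/4)^n D_{i+1} + (3/4)^n D_{i+2})`, where `D_j` is the squared
increment along the edge of the cell opposite to its `j`-th vertex; its main direction is the one
opposite to `p_i`. -/
def anisotropicEnergy (i : Fin 3) (n : ℕ) (u : SG → ℝ) : ℝ :=
  2 ^ n * ∑ ω : Fin n → Fin 3, (cellDiffSq u ω i + (3 / 4) ^ n * cellDiffSq u ω (i + 1)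
    + (3 / 4) ^ n * cellDiffSq u ω (i + 2))

end

end Gasket

/-! The star-triangle transform replaces the conductances of a cell by the resistances `(x, y, z)`
of an equivalent star. In three glued cells the inner star legs form a loop with resistances `x +
y`, `y + z`, `z + x`. Turning this loop into a star shows that the trace is again a star, with `X =
3/2 x + yz / (2(x+y+z))` and its cyclic analogues (`exists_harmonic_extension`, `isLeast_trace`).
Cells of level `n` share no new vertices, so the minimization splits over them, and compatibility
says exactly that the star resistances form a positive backward orbit of this trace map
(`isRecursiveConstruction_iff`).

Along such an orbit the sum of the resistances shrinks at least by `2/3` per level, while the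
difference of the two that are not largest shrinks at most by `3/4`. The difference never exceeds
the sum, so it vanishes (`IsStarOrbit.eq_zero`). Conversely, on triples `(x, y, y)` with `y ≤ x` the
trace map is invertible, because it is homogeneous and the ratio `y / x` can be recovered; this
gives uniqueness and existence (`eq_of_trace_eq`, `exists_trace_eq`).

Compatibility makes the level energies monotone, so they converge. If `x = y`, the map multiplies by
`5/3`. If `y < x`, then `x` decays like `(2/3)^n` and `y` like `2^(-n)` up to constants
(`bound_one`, `bound_two`). The conductances `1/(2x+y)` and `x/(y(2x+y))` are then comparable to
`(3/2)^n` and `2^n`, and the energies are compared term by term. -/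

namespace Gasket

noncomputable section

/-! ### Barycentric coordinates and the intersections of cells -/

/-- The barycentric coordinates of a point of the plane with respect to the three corners. -/
def bary : Fin 3 → ℂ → ℝ :=
  ![fun z => 1 - z.re - z.im / √3, fun z => z.re - z.im / √3, fun z => 2 * (z.im / √3)]

lemma corner_two : corner 2 = ⟨1 / 2, √3 / 2⟩ := by
  have h : corner 2 = Complex.exp (((Real.pi / 3 : ℝ) : ℂ) * Complex.I) := by
    simp only [corner, Matrix.cons_val]
    congr 1
    push_cast
    ring
  rw [h]
  apply Complex.ext
  · rw [Complex.exp_ofReal_mul_I_re, Real.cos_pi_div_three]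
  · rw [Complex.exp_ofReal_mul_I_im, Real.sin_pi_div_three]

lemma bary_corner (k j : Fin 3) : bary k (corner j) = if k = j then 1 else 0 := by
  have h3 : √3 ≠ 0 := by positivity
  have e : (√3 / 2) / √3 = 1 / 2 := by field_simp
  have h2 := corner_two
  have h0 : corner 0 = 0 := rfl
  have h1 : corner 1 = 1 := rfl
  fin_cases j <;> fin_cases k <;> simp [bary, h0, h1, h2, e] <;> norm_num

lemma bary_contr (k i : Fin 3) (z : ℂ) :
    bary k (contr i z) = (bary k z + if k = i then 1 else 0) / 2 := by
  rw [← bary_corner, contr_eq]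
  fin_cases k <;> simp [bary] <;> ring

lemma bary_sum (z : ℂ) : bary 0 z + bary 1 z + bary 2 z = 1 := by
  simp [bary]; ring

lemma bary_ext {z w : ℂ} (h : ∀ k, bary k z = bary k w) : z = w := by
  have h3 : √3 ≠ 0 := by positivity
  have h1 := h 1
  have h2 := h 2
  simp only [bary, Matrix.cons_val] at h1 h2
  have him : z.im / √3 = w.im / √3 := by linarith
  refine Complex.ext (by linarith) ?_
  field_simp at him
  exact him

lemma continuous_bary (k : Fin 3) : Continuous (bary k) := by
  fin_cases k <;> simp [bary] <;> fun_prop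

/-- A minimum principle: the minimum over the gasket is attained at some `contr i y`, where the
coordinate is at least half its value at `y`, hence at least half the minimum. A negative minimum
would contradict this. -/
lemma bary_nonneg (k : Fin 3) {z : ℂ} (hz : z ∈ gasket) : 0 ≤ bary k z := by
  obtain ⟨x, hx, hmin⟩ := isAttractor_gasket.2.1.exists_isMinOn isAttractor_gasket.1
    (continuous_bary k).continuousOn
  have hx' := hx
  rw [isAttractor_gasket.2.2] at hx'
  obtain ⟨i, y, hy, rfl⟩ := mem_iUnion.1 hx'
  have h1 : bary k (contr i y) ≤ bary k y := hmin hy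
  have h2 : bary k (contr i y) ≤ bary k z := hmin hz
  have h3 := bary_contr k i y
  split_ifs at h3 <;> linarith

lemma bary_sum_eq (i : Fin 3) (z : ℂ) : bary i z + bary (i + 1) z + bary (i + 2) z = 1 := by
  have := bary_sum z
  fin_cases i <;> simp <;> linarith

lemma fin_three_cases : ∀ j k : Fin 3, j = k ∨ j = k + 1 ∨ j = k + 2 := by decide

lemma eq_vert_of_one_le {x : SG} {k : Fin 3} (h : 1 ≤ bary k x) : x = vert k := by
  have h1 := bary_nonneg (k + 1) x.2
  have h2 := bary_nonneg (k + 2) x.2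
  have h3 := bary_sum_eq k x
  apply Subtype.ext
  apply bary_ext
  intro j
  have hj : j = k ∨ j = k + 1 ∨ j = k + 2 := fin_three_cases j k
  change _ = bary j (corner k)
  rw [bary_corner]
  rcases hj with rfl | rfl | rfl
  · simp; linarith
  · simp; linarith
  · simp; linarith

lemma bary_le_one (k : Fin 3) (x : SG) : bary k x ≤ 1 := by
  have h1 := bary_nonneg (k + 1) x.2
  have h2 := bary_nonneg (k + 2) x.2
  have h3 := bary_sum_eq k x
  linarith

lemma bary_vert (k j : Fin 3) : bary k (vert j : SG) = if k = j then 1 else 0 :=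
  bary_corner k j

lemma bary_cellMap (k i : Fin 3) (x : SG) :
    bary k (cellMap i x : SG) = (bary k x + if k = i then 1 else 0) / 2 :=
  bary_contr k i x

lemma vert_injective : Function.Injective vert := by
  intro i j h
  have := bary_vert i i
  rw [h, bary_vert] at this
  by_contra hij
  simp [hij] at this

lemma cellMap_injective (i : Fin 3) : Function.Injective (cellMap i) := by
  intro x y h
  have h' : contr i x = contr i y := congrArg Subtype.val h
  rw [contr_eq, contr_eq] at h'
  apply Subtype.ext
  linear_combination 2 * h'

lemma cellMap_eq_vert {a k : Fin 3} {x : SG} : cellMap a x = vert k ↔ a = k ∧ x = vert k := by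
  constructor
  · intro h
    have h1 := bary_cellMap k a x
    rw [h, bary_vert] at h1
    have h2 := bary_le_one k x
    by_cases hk : k = a
    · simp only [hk, if_true] at h1 h2 ⊢
      exact ⟨trivial, eq_vert_of_one_le (by linarith)⟩
    · simp only [hk, if_false, if_true] at h1
      linarith
  · rintro ⟨rfl, rfl⟩
    apply Subtype.ext
    change contr a (corner a) = corner a
    rw [contr_eq]; ring

lemma cellMap_vert_comm (i j : Fin 3) : cellMap i (vert j) = cellMap j (vert i) := by
  apply Subtype.ext
  change contr i (corner j) = contr j (corner i)
  rw [contr_eq, contr_eq]; ring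

/-- Two distinct cells of level one meet only in their common vertex. -/
lemma eq_vert_of_cellMap_eq {i j : Fin 3} (hij : i ≠ j) {x y : SG}
    (h : cellMap i x = cellMap j y) : x = vert j := by
  have h1 := bary_cellMap j i x
  rw [h, bary_cellMap] at h1
  have h2 := bary_nonneg j y.2
  simp only [if_true, hij.symm, if_false] at h1
  exact eq_vert_of_one_le (by linarith)

/-- A corner lies in only one cell of each level, so its indicator function has energy in a single
cell. -/
lemma wordMap_eq_vert {n : ℕ} {ω : Fin n → Fin 3} {x : SG} {k : Fin 3} :
    wordMap n ω x = vert k ↔ (ω = fun _ => k) ∧ x = vert k := by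
  induction n with
  | zero => simp [wordMap, Subsingleton.elim ω (fun _ => k)]
  | succ n ih =>
    rw [wordMap, Function.comp_apply, cellMap_eq_vert, ih, ← and_assoc]
    refine and_congr_left fun _ => ⟨fun h => ?_, fun h => ?_⟩
    · rw [← Fin.cons_self_tail ω, h.1, h.2]
      funext i
      refine Fin.cases rfl (fun _ => rfl) i
    · subst h
      exact ⟨rfl, rfl⟩

lemma wordMap_injective (n : ℕ) (ω : Fin n → Fin 3) : Function.Injective (wordMap n ω) := by
  induction n with
  | zero => exact Function.injective_id
  | succ n ih => exact (cellMap_injective _).comp (ih _)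

/-- `wordMap` peels off the first letter, whereas subdividing a cell of level `n` appends a last
one. -/
lemma wordMap_snoc (n : ℕ) (ω : Fin n → Fin 3) (j : Fin 3) (x : SG) :
    wordMap (n + 1) (Fin.snoc ω j : Fin (n + 1) → Fin 3) x = wordMap n ω (cellMap j x) := by
  induction n with
  | zero => rfl
  | succ n ih =>
    rw [wordMap, Function.comp_apply]
    have h : Fin.tail (Fin.snoc ω j : Fin (n + 2) → Fin 3) =
        (Fin.snoc (Fin.tail ω) j : Fin (n + 1) → Fin 3) := by
      funext i
      refine Fin.lastCases ?_ (fun i => ?_) i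
      · rw [Fin.tail, Fin.succ_last, Fin.snoc_last, Fin.snoc_last]
      · rw [Fin.tail, Fin.succ_castSucc, Fin.snoc_castSucc, Fin.snoc_castSucc, Fin.tail]
    rw [h, ih]
    have h0 : (Fin.snoc ω j : Fin (n + 2) → Fin 3) 0 = ω 0 := by
      rw [← Fin.castSucc_zero, Fin.snoc_castSucc]
    rw [h0]
    rfl

lemma mem_vertices {n : ℕ} {x : SG} :
    x ∈ vertices n ↔ ∃ (ω : Fin n → Fin 3) (k : Fin 3), wordMap n ω (vert k) = x := by
  induction n generalizing x with
  | zero => simp [vertices, wordMap]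
  | succ n ih =>
    simp only [vertices, mem_iUnion, mem_image, ih]
    constructor
    · rintro ⟨i, _, ⟨ω, k, rfl⟩, rfl⟩
      exact ⟨Fin.cons i ω, k, by simp [wordMap]⟩
    · rintro ⟨ω, k, rfl⟩
      exact ⟨ω 0, _, ⟨Fin.tail ω, k, rfl⟩, rfl⟩

/-! ### The new vertices of level `n + 1` -/

/-- The midpoint of the side opposite to `vert k`. -/
def midpt (k : Fin 3) : SG := cellMap (k + 1) (vert (k + 2))

lemma bary_midpt (k j : Fin 3) : bary j (midpt k : SG) = if j = k then 0 else 1 / 2 := by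
  rw [midpt, bary_cellMap, bary_vert]
  fin_cases k <;> fin_cases j <;> simp

lemma midpt_injective : Function.Injective midpt := by
  intro i j h
  have := bary_midpt i i
  rw [h, bary_midpt] at this
  by_contra hij
  simp [hij] at this

lemma midpt_ne_vert (k j : Fin 3) : midpt k ≠ vert j := by
  intro h
  have := bary_midpt k j
  rw [h, bary_vert, if_pos rfl] at this
  split_ifs at this <;> norm_num at this

/-- As `0 + 1 + 2 = 0` in `Fin 3`, the index that differs from `j` and `k` is `-(j + k)`. -/
lemma cellMap_vert_eq_midpt {j k : Fin 3} (h : j ≠ k) : cellMap j (vert k) = midpt (-(j + k)) := by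
  have hc : (j = -(j + k) + 1 ∧ k = -(j + k) + 2) ∨ (k = -(j + k) + 1 ∧ j = -(j + k) + 2) := by
    revert j k; decide
  rw [midpt]
  rcases hc with h | h
  · rw [← h.1, ← h.2]
  · rw [← h.1, ← h.2, cellMap_vert_comm]

lemma wordMap_midpt_notMem (n : ℕ) (ω : Fin n → Fin 3) (k : Fin 3) :
    wordMap n ω (midpt k) ∉ vertices n := by
  induction n with
  | zero =>
    rintro ⟨j, hj⟩
    exact midpt_ne_vert k j hj.symm
  | succ n ih =>
    intro h
    simp only [vertices, mem_iUnion, mem_image] at h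
    obtain ⟨i, y, hy, hyx⟩ := h
    rw [wordMap, Function.comp_apply] at hyx
    by_cases hi : ω 0 = i
    · rw [hi] at hyx
      exact ih _ (cellMap_injective i hyx ▸ hy)
    · exact midpt_ne_vert _ _ (wordMap_eq_vert.1 (eq_vert_of_cellMap_eq hi hyx.symm)).2

/-- Distinct cells of one level meet only in images of corners. Values at midpoints can therefore be
prescribed cell by cell without conflict. -/
lemma wordMap_midpt_inj {n : ℕ} {ω ω' : Fin n → Fin 3} {k k' : Fin 3}
    (h : wordMap n ω (midpt k) = wordMap n ω' (midpt k')) : ω = ω' ∧ k = k' := by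
  induction n with
  | zero => exact ⟨Subsingleton.elim _ _, midpt_injective h⟩
  | succ n ih =>
    rw [wordMap, wordMap, Function.comp_apply, Function.comp_apply] at h
    by_cases hi : ω 0 = ω' 0
    · rw [hi] at h
      obtain ⟨h1, h2⟩ := ih (cellMap_injective _ h)
      exact ⟨by rw [← Fin.cons_self_tail ω, ← Fin.cons_self_tail ω', hi, h1], h2⟩
    · exact absurd (wordMap_eq_vert.1 (eq_vert_of_cellMap_eq hi h)).2 (midpt_ne_vert _ _)

/-- A function on `V_n` extends to a function with prescribed values at the midpoints of the sides
of the cells of level `n`. -/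
lemma exists_extension (n : ℕ) (v : SG → ℝ) (q : (Fin n → Fin 3) → Fin 3 → ℝ) :
    ∃ u : SG → ℝ, EqOn u v (vertices n) ∧ ∀ ω k, u (wordMap n ω (midpt k)) = q ω k := by
  classical
  refine ⟨fun x => if h : ∃ p : (Fin n → Fin 3) × Fin 3, wordMap n p.1 (midpt p.2) = x then
    q h.choose.1 h.choose.2 else v x, fun x hx => ?_, fun ω k => ?_⟩
  · refine dif_neg ?_
    rintro ⟨p, rfl⟩
    exact wordMap_midpt_notMem _ _ _ hx
  · have h : ∃ p : (Fin n → Fin 3) × Fin 3,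
        wordMap n p.1 (midpt p.2) = wordMap n ω (midpt k) := ⟨(ω, k), rfl⟩
    simp only [dif_pos h]
    obtain ⟨h1, h2⟩ := wordMap_midpt_inj h.choose_spec
    rw [h1, h2]

/-! ### Trace of three glued triangles -/

/-- The energy of a triangle with conductances `a, b, c` on the edges opposite to its vertices and
with potentials `u, v, w` at the vertices. -/
def triangleForm (a b c u v w : ℝ) : ℝ := a * (v - w) ^ 2 + b * (w - u) ^ 2 + c * (u - v) ^ 2

lemma triangleForm_nonneg {a b c : ℝ} (ha : 0 ≤ a) (hb : 0 ≤ b) (hc : 0 ≤ c) (u v w : ℝ) :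
    0 ≤ triangleForm a b c u v w := by
  unfold triangleForm; positivity

/-- Energy of a perturbed potential on a triangle equivalent to a star with resistances `x, y, z`,
where the unperturbed potential is given by the currents `I, J, K` in the star. -/
lemma triangleForm_add {x y z : ℝ} (hx : 0 < x) (hy : 0 < y) (hz : 0 < z) {I J K : ℝ}
    (hI : I + J + K = 0) (m u v w : ℝ) :
    triangleForm (x / (x * y + y * z + z * x)) (y / (x * y + y * z + z * x))
        (z / (x * y + y * z + z * x)) (m + x * I + u) (m + y * J + v) (m + z * K + w) =
      triangleForm (x / (x * y + y * z + z * x)) (y / (x * y + y * z + z * x))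
        (z / (x * y + y * z + z * x)) u v w + 2 * (I * u + J * v + K * w) +
        (x * I ^ 2 + y * J ^ 2 + z * K ^ 2) := by
  have hK : K = -I - J := by linarith
  subst hK
  have he : x * y + y * z + z * x ≠ 0 := by positivity
  unfold triangleForm
  field_simp
  ring

/-- Every potential on the vertices of a triangle comes from currents in the equivalent star. -/
lemma exists_star_currents {x y z : ℝ} (hx : 0 < x) (hy : 0 < y) (hz : 0 < z) (p₁ p₂ p₃ : ℝ) :
    ∃ m I J K : ℝ, I + J + K = 0 ∧ p₁ = m + x * I ∧ p₂ = m + y * J ∧ p₃ = m + z * K := by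
  have he : x * y + y * z + z * x ≠ 0 := by positivity
  refine ⟨(p₁ * (y * z) + p₂ * (z * x) + p₃ * (x * y)) / (x * y + y * z + z * x),
    (z * (p₁ - p₂) + y * (p₁ - p₃)) / (x * y + y * z + z * x),
    (z * (p₂ - p₁) + x * (p₂ - p₃)) / (x * y + y * z + z * x),
    (y * (p₃ - p₁) + x * (p₃ - p₂)) / (x * y + y * z + z * x), ?_, ?_, ?_, ?_⟩ <;>
  · field_simp
    ring

/-- The network of three triangles is equivalent to a single star: the energy of any potential is
the energy of the trace plus the energy of the deviation from the harmonic extension. -/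
lemma exists_harmonic_extension {x y z : ℝ} (hx : 0 < x) (hy : 0 < y) (hz : 0 < z)
    {a b c : ℝ} (ha : a = x / (x * y + y * z + z * x)) (hb : b = y / (x * y + y * z + z * x))
    (hc : c = z / (x * y + y * z + z * x))
    {X Y Z : ℝ} (hX : X = 3 / 2 * x + y * z / (2 * (x + y + z)))
    (hY : Y = 3 / 2 * y + z * x / (2 * (x + y + z)))
    (hZ : Z = 3 / 2 * z + x * y / (2 * (x + y + z)))
    {A B C : ℝ} (hA : A = X / (X * Y + Y * Z + Z * X)) (hB : B = Y / (X * Y + Y * Z + Z * X))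
    (hC : C = Z / (X * Y + Y * Z + Z * X)) (p₁ p₂ p₃ : ℝ) :
    ∃ h₁ h₂ h₃ : ℝ, ∀ q₁ q₂ q₃ : ℝ,
      triangleForm a b c p₁ q₃ q₂ + triangleForm a b c q₃ p₂ q₁ + triangleForm a b c q₂ q₁ p₃ =
        triangleForm A B C p₁ p₂ p₃ + (triangleForm a b c 0 (q₃ - h₃) (q₂ - h₂) +
          triangleForm a b c (q₃ - h₃) 0 (q₁ - h₁) + triangleForm a b c (q₂ - h₂) (q₁ - h₁) 0) := by
  have hX0 : 0 < X := by rw [hX]; positivity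
  have hY0 : 0 < Y := by rw [hY]; positivity
  have hZ0 : 0 < Z := by rw [hZ]; positivity
  obtain ⟨m, I, J, K, hI, rfl, rfl, rfl⟩ := exists_star_currents hX0 hY0 hZ0 p₁ p₂ p₃
  have hs : x + y + z ≠ 0 := by positivity
  have htr := triangleForm_add hX0 hY0 hZ0 hI m 0 0 0
  rw [← hA, ← hB, ← hC] at htr
  have hK : K = -I - J := by linarith
  -- The total resistance of the inner loop. Below, `f₁₂`, `f₂₃`, `f₃₁` are the currents between the
  -- cells, `m₁`, `m₂`, `m₃` the potentials at the star centres of the cells and `h₁`, `h₂`, `h₃`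
  -- the harmonic potentials at the midpoints.
  set s := 2 * (x + y + z) with hs2
  have hs' : s ≠ 0 := by positivity
  set f₁₂ := ((x + z) * I - (y + z) * J) / s with h12
  set f₂₃ := ((y + x) * J - (z + x) * K) / s with h23
  set f₃₁ := ((z + y) * K - (x + y) * I) / s with h31
  set m₁ := m + (x + y) * (x + z) / s * I with hm1
  set m₂ := m + (y + z) * (y + x) / s * J with hm2
  set m₃ := m + (z + x) * (z + y) / s * K with hm3
  set h₃ := m + (x * (x + z) * I + y * (y + z) * J) / s with hh3
  set h₁ := m + (y * (y + x) * J + z * (z + x) * K) / s with hh1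
  set h₂ := m + (z * (z + y) * K + x * (x + y) * I) / s with hh2
  -- Kirchhoff's current law at the three star centres, as `triangleForm_add` requires.
  have s1 : I + -f₁₂ + f₃₁ = 0 := by
    rw [h12, h31, hK]; field_simp; rw [hs2]; ring
  have s2 : f₁₂ + J + -f₂₃ = 0 := by
    rw [h12, h23, hK]; field_simp; rw [hs2]; ring
  have s3 : -f₃₁ + f₂₃ + K = 0 := by
    rw [h23, h31, hK]; field_simp; rw [hs2]; ring
  refine ⟨h₁, h₂, h₃, fun q₁ q₂ q₃ => ?_⟩
  have c1 := triangleForm_add hx hy hz s1 m₁ 0 (q₃ - h₃) (q₂ - h₂)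
  have c2 := triangleForm_add hx hy hz s2 m₂ (q₃ - h₃) 0 (q₁ - h₁)
  have c3 := triangleForm_add hx hy hz s3 m₃ (q₂ - h₂) (q₁ - h₁) 0
  rw [← ha, ← hb, ← hc] at c1 c2 c3
  have e1 : m₁ + x * I + 0 = m + X * I := by rw [hm1, hX]; field_simp; rw [hs2]; ring
  have e2 : m₂ + y * J + 0 = m + Y * J := by rw [hm2, hY]; field_simp; rw [hs2]; ring
  have e3 : m₃ + z * K + 0 = m + Z * K := by rw [hm3, hZ]; field_simp; rw [hs2]; ring
  have e12 : m₁ + y * -f₁₂ + (q₃ - h₃) = q₃ := by rw [hm1, h12, hh3]; field_simp; ring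
  have e13 : m₁ + z * f₃₁ + (q₂ - h₂) = q₂ := by rw [hm1, h31, hh2]; field_simp; ring
  have e21 : m₂ + x * f₁₂ + (q₃ - h₃) = q₃ := by rw [hm2, h12, hh3]; field_simp; ring
  have e23 : m₂ + z * -f₂₃ + (q₁ - h₁) = q₁ := by rw [hm2, h23, hh1]; field_simp; ring
  have e31 : m₃ + x * -f₃₁ + (q₂ - h₂) = q₂ := by rw [hm3, h31, hh2]; field_simp; ring
  have e32 : m₃ + y * f₂₃ + (q₁ - h₁) = q₁ := by rw [hm3, h23, hh1]; field_simp; ring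
  rw [e1, e12, e13] at c1
  rw [e2, e21, e23] at c2
  rw [e3, e31, e32] at c3
  -- The power dissipated in the small stars equals that in the large one. The terms linear in the
  -- deviations cancel, since each inner current enters one cell and leaves another.
  have hdiss : x * I ^ 2 + y * (-f₁₂) ^ 2 + z * f₃₁ ^ 2 + (x * f₁₂ ^ 2 + y * J ^ 2 + z * (-f₂₃) ^ 2)
      + (x * (-f₃₁) ^ 2 + y * f₂₃ ^ 2 + z * K ^ 2) = X * I ^ 2 + Y * J ^ 2 + Z * K ^ 2 := by
    rw [h12, h23, h31, hX, hY, hZ, hK]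
    field_simp
    rw [hs2]
    ring
  have h0 : triangleForm A B C 0 0 0 = 0 := by simp [triangleForm]
  rw [h0] at htr
  simp only [add_zero] at htr
  rw [c1, c2, c3, htr, ← hdiss]
  ring

/-! ### Level energies and compatibility in star resistances -/

/-- The star-triangle transform: it exchanges the conductances of a triangle, indexed by the
opposite vertices, and the resistances of the equivalent star. -/
def star (c : Fin 3 → ℝ) (i : Fin 3) : ℝ := c i / (c 0 * c 1 + c 1 * c 2 + c 2 * c 0)

/-- The star resistances of the trace of a network of three cells with star resistances `x`. -/
def traceStar (x : Fin 3 → ℝ) (i : Fin 3) : ℝ :=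
  3 / 2 * x i + x (i + 1) * x (i + 2) / (2 * (x 0 + x 1 + x 2))

lemma star_pos {c : Fin 3 → ℝ} (hc : ∀ i, 0 < c i) (i : Fin 3) : 0 < star c i := by
  have := hc 0; have := hc 1; have := hc 2; have := hc i
  unfold star; positivity

lemma traceStar_pos {x : Fin 3 → ℝ} (hx : ∀ i, 0 < x i) (i : Fin 3) : 0 < traceStar x i := by
  have := hx 0; have := hx 1; have := hx 2; have := hx i; have := hx (i + 1); have := hx (i + 2)
  unfold traceStar; positivity

lemma star_star {c : Fin 3 → ℝ} (hc : ∀ i, 0 < c i) : star (star c) = c := by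
  have := hc 0; have := hc 1; have := hc 2
  have he : c 0 * c 1 + c 1 * c 2 + c 2 * c 0 ≠ 0 := by positivity
  funext i
  simp only [star]
  generalize hE : c 0 * c 1 + c 1 * c 2 + c 2 * c 0 = E at he ⊢
  have : c 0 / E * (c 1 / E) + c 1 / E * (c 2 / E) + c 2 / E * (c 0 / E) = 1 / E := by
    field_simp
    rw [← hE]
    ring
  rw [this]
  field_simp

lemma levelEnergy_eq (n : ℕ) (c : Fin 3 → ℝ) (u : SG → ℝ) :
    levelEnergy n c u = ∑ ω : Fin n → Fin 3, triangleForm (c 0) (c 1) (c 2)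
      (u (wordMap n ω (vert 0))) (u (wordMap n ω (vert 1))) (u (wordMap n ω (vert 2))) := by
  unfold levelEnergy triangleForm
  refine Finset.sum_congr rfl fun ω _ => ?_
  rw [Fin.sum_univ_three]
  rfl

lemma levelEnergy_smul (n : ℕ) (r : ℝ) (c : Fin 3 → ℝ) (u : SG → ℝ) :
    levelEnergy n (fun i => r * c i) u = r * levelEnergy n c u := by
  simp only [levelEnergy, Finset.mul_sum, mul_assoc]

lemma cellMap_vert_self (i : Fin 3) : cellMap i (vert i) = vert i := cellMap_eq_vert.2 ⟨rfl, rfl⟩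

lemma levelEnergy_succ (n : ℕ) (c : Fin 3 → ℝ) (u : SG → ℝ) :
    levelEnergy (n + 1) c u = ∑ ω : Fin n → Fin 3,
      (triangleForm (c 0) (c 1) (c 2) (u (wordMap n ω (vert 0))) (u (wordMap n ω (midpt 2)))
          (u (wordMap n ω (midpt 1))) +
        triangleForm (c 0) (c 1) (c 2) (u (wordMap n ω (midpt 2))) (u (wordMap n ω (vert 1)))
          (u (wordMap n ω (midpt 0))) +
        triangleForm (c 0) (c 1) (c 2) (u (wordMap n ω (midpt 1))) (u (wordMap n ω (midpt 0)))
          (u (wordMap n ω (vert 2)))) := by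
  rw [levelEnergy_eq, ← (Fin.snocEquiv fun _ => Fin 3).sum_comp, Fintype.sum_prod_type_right]
  refine Finset.sum_congr rfl fun ω _ => ?_
  simp only [Fin.snocEquiv, Equiv.coe_fn_mk]
  rw [Fin.sum_univ_three]
  simp only [wordMap_snoc, cellMap_vert_self]
  rw [cellMap_vert_eq_midpt (show (0 : Fin 3) ≠ 1 by decide),
    cellMap_vert_eq_midpt (show (0 : Fin 3) ≠ 2 by decide),
    cellMap_vert_eq_midpt (show (1 : Fin 3) ≠ 0 by decide),
    cellMap_vert_eq_midpt (show (1 : Fin 3) ≠ 2 by decide),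
    cellMap_vert_eq_midpt (show (2 : Fin 3) ≠ 0 by decide),
    cellMap_vert_eq_midpt (show (2 : Fin 3) ≠ 1 by decide)]
  rfl

/-- The trace of the energy of level `n + 1` on `V_n`. -/
theorem isLeast_trace (n : ℕ) {c : Fin 3 → ℝ} (hc : ∀ i, 0 < c i) (v : SG → ℝ) :
    IsLeast {t : ℝ | ∃ u : SG → ℝ, EqOn u v (vertices n) ∧ t = levelEnergy (n + 1) c u}
      (levelEnergy n (star (traceStar (star c))) v) := by
  have hx := star_pos hc
  have key := fun ω : Fin n → Fin 3 => exists_harmonic_extension (hx 0) (hx 1) (hx 2)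
    (congrFun (star_star hc) 0).symm (congrFun (star_star hc) 1).symm
    (congrFun (star_star hc) 2).symm
    (X := traceStar (star c) 0) (Y := traceStar (star c) 1) (Z := traceStar (star c) 2)
    rfl rfl rfl (A := star (traceStar (star c)) 0) (B := star (traceStar (star c)) 1)
    (C := star (traceStar (star c)) 2) rfl rfl rfl
    (v (wordMap n ω (vert 0))) (v (wordMap n ω (vert 1))) (v (wordMap n ω (vert 2)))
  choose h₁ h₂ h₃ hh using key
  have heq : ∀ u : SG → ℝ, EqOn u v (vertices n) → ∀ ω k,
      u (wordMap n ω (vert k)) = v (wordMap n ω (vert k)) := fun u hu ω k =>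
    hu (mem_vertices.2 ⟨ω, k, rfl⟩)
  constructor
  -- The harmonic values at the midpoints make every deviation term vanish, so the minimum is
  -- attained.
  · obtain ⟨u, hu, huq⟩ := exists_extension n v fun ω => ![h₁ ω, h₂ ω, h₃ ω]
    refine ⟨u, hu, ?_⟩
    rw [levelEnergy_eq, levelEnergy_succ]
    refine Finset.sum_congr rfl fun ω _ => ?_
    rw [heq u hu, heq u hu, heq u hu, hh, huq, huq, huq]
    simp [triangleForm]
  · rintro _ ⟨u, hu, rfl⟩
    rw [levelEnergy_eq, levelEnergy_succ]
    refine Finset.sum_le_sum fun ω _ => ?_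
    rw [heq u hu, heq u hu, heq u hu, hh]
    have hnn := triangleForm_nonneg (hc 0).le (hc 1).le (hc 2).le
    linarith [hnn 0 (u (wordMap n ω (midpt 2)) - h₃ ω) (u (wordMap n ω (midpt 1)) - h₂ ω),
      hnn (u (wordMap n ω (midpt 2)) - h₃ ω) 0 (u (wordMap n ω (midpt 0)) - h₁ ω),
      hnn (u (wordMap n ω (midpt 1)) - h₂ ω) (u (wordMap n ω (midpt 0)) - h₁ ω) 0]

/-- The energy of the indicator function of a corner. -/
lemma levelEnergy_single (n : ℕ) (c : Fin 3 → ℝ) (i : Fin 3) :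
    levelEnergy n c (fun x => Set.indicator {vert i} 1 x) = c (i + 1) + c (i + 2) := by
  classical
  rw [levelEnergy_eq, Finset.sum_eq_single fun _ => i]
  · have h : ∀ k, Set.indicator {vert i} (1 : SG → ℝ) (wordMap n (fun _ => i) (vert k)) =
        if k = i then 1 else 0 := by
      intro k
      simp [Set.indicator_apply, wordMap_eq_vert, vert_injective.eq_iff]
    simp only [h]
    fin_cases i <;> simp [triangleForm] <;> ring
  · intro ω _ hω
    have h : ∀ k, Set.indicator {vert i} (1 : SG → ℝ) (wordMap n ω (vert k)) = 0 := by
      intro k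
      simp [wordMap_eq_vert, hω]
    simp [h, triangleForm]
  · simp

/-- Indicators of the corners give the pairwise sums of the conductances, and these determine all
three. -/
lemma levelEnergy_injective (n : ℕ) {c c' : Fin 3 → ℝ}
    (h : ∀ u, levelEnergy n c u = levelEnergy n c' u) : c = c' := by
  have h' : ∀ i, c (i + 1) + c (i + 2) = c' (i + 1) + c' (i + 2) := fun i => by
    rw [← levelEnergy_single n, ← levelEnergy_single n, h]
  have h0 := h' 0
  have h1 := h' 1
  have h2 := h' 2
  simp only [Fin.isValue, Fin.reduceAdd] at h0 h1 h2
  funext i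
  fin_cases i <;> simp only [Fin.isValue, Fin.reduceFinMk, Fin.zero_eta, Fin.mk_one] <;> linarith

/-- Compatibility of the energies in terms of star resistances. -/
theorem isRecursiveConstruction_iff {c₀ : Fin 3 → ℝ} {c : ℕ → Fin 3 → ℝ} :
    IsRecursiveConstruction c₀ c ↔ c 0 = c₀ ∧ (∀ n i, 0 < c n i) ∧
      ∀ n, star (c n) = traceStar (star (c (n + 1))) := by
  constructor
  · rintro ⟨h0, hpos, hc⟩
    refine ⟨h0, hpos, fun n => ?_⟩
    have h : c n = star (traceStar (star (c (n + 1)))) := levelEnergy_injective n fun v =>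
      (hc n v).unique (isLeast_trace n (hpos (n + 1)) v)
    rw [h, star_star (traceStar_pos (star_pos (hpos _)))]
  · rintro ⟨h0, hpos, hc⟩
    refine ⟨h0, hpos, fun n v => ?_⟩
    have h := isLeast_trace n (hpos (n + 1)) v
    rwa [← hc n, star_star (hpos n)] at h

/-! ### Backward orbits of the trace map -/

/-- Positive sequences of star resistances that are consistent with taking traces. -/
structure IsStarOrbit (x y z : ℕ → ℝ) : Prop where
  pos₁ : ∀ n, 0 < x n
  pos₂ : ∀ n, 0 < y n
  pos₃ : ∀ n, 0 < z n
  step₁ : ∀ n, x n = 3 / 2 * x (n + 1) +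
    y (n + 1) * z (n + 1) / (2 * (x (n + 1) + y (n + 1) + z (n + 1)))
  step₂ : ∀ n, y n = 3 / 2 * y (n + 1) +
    z (n + 1) * x (n + 1) / (2 * (x (n + 1) + y (n + 1) + z (n + 1)))
  step₃ : ∀ n, z n = 3 / 2 * z (n + 1) +
    x (n + 1) * y (n + 1) / (2 * (x (n + 1) + y (n + 1) + z (n + 1)))

namespace IsStarOrbit

variable {x y z : ℕ → ℝ}

lemma rotate (h : IsStarOrbit x y z) : IsStarOrbit y z x where
  pos₁ := h.pos₂
  pos₂ := h.pos₃
  pos₃ := h.pos₁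
  step₁ n := by rw [h.step₂ n]; ring
  step₂ n := by rw [h.step₃ n]; ring
  step₃ n := by rw [h.step₁ n]; ring

lemma shift (h : IsStarOrbit x y z) (m : ℕ) :
    IsStarOrbit (fun n => x (n + m)) (fun n => y (n + m)) (fun n => z (n + m)) where
  pos₁ n := h.pos₁ _
  pos₂ n := h.pos₂ _
  pos₃ n := h.pos₃ _
  step₁ n := by rw [h.step₁ (n + m), add_right_comm]
  step₂ n := by rw [h.step₂ (n + m), add_right_comm]
  step₃ n := by rw [h.step₃ (n + m), add_right_comm]

/-- The two product terms share the factor `z`. The resulting multiplier lies strictly between `1`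
and `3/2`, so the order of two resistances is the same at all levels. -/
lemma sub_eq (h : IsStarOrbit x y z) (n : ℕ) :
    x n - y n = (3 / 2 - z (n + 1) / (2 * (x (n + 1) + y (n + 1) + z (n + 1)))) *
      (x (n + 1) - y (n + 1)) := by
  rw [h.step₁ n, h.step₂ n]; ring

lemma sub_factor_pos (h : IsStarOrbit x y z) (n : ℕ) :
    0 < 3 / 2 - z (n + 1) / (2 * (x (n + 1) + y (n + 1) + z (n + 1))) := by
  have h1 := h.pos₁ (n + 1)
  have h2 := h.pos₂ (n + 1)
  have h3 := h.pos₃ (n + 1)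
  rw [sub_pos, div_lt_iff₀ (by positivity)]
  linarith

lemma le_of_le (h : IsStarOrbit x y z) (h0 : y 0 ≤ x 0) (n : ℕ) : y n ≤ x n := by
  induction n with
  | zero => exact h0
  | succ n ih =>
    have h1 := h.sub_eq n
    have h2 : 0 ≤ x (n + 1) - y (n + 1) := by
      by_contra! hneg
      have := mul_neg_of_pos_of_neg (h.sub_factor_pos n) hneg
      linarith
    linarith

lemma lt_of_lt (h : IsStarOrbit x y z) (h0 : y 0 < x 0) (n : ℕ) : y n < x n := by
  induction n with
  | zero => exact h0
  | succ n ih =>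
    have h1 := h.sub_eq n
    have h2 : 0 < x (n + 1) - y (n + 1) := by
      by_contra! hneg
      have := mul_nonpos_of_nonneg_of_nonpos (h.sub_factor_pos n).le hneg
      linarith
    linarith

/-- The two smaller resistances of a consistent sequence agree: otherwise their relative difference
would grow exponentially. -/
lemma eq_zero (h : IsStarOrbit x y z) (h1 : y 0 ≤ x 0) (h2 : z 0 ≤ x 0) : y 0 = z 0 := by
  have hy := h.le_of_le h1
  have hz : ∀ n, z n ≤ x n := fun n => by
    induction n with
    | zero => exact h2
    | succ n ih =>
      have h3 := h.rotate.rotate.sub_eq n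
      by_contra! hneg
      have := mul_pos (h.rotate.rotate.sub_factor_pos n) (sub_pos.2 hneg)
      linarith
  -- Dropping the nonnegative product terms leaves the factor `3/2` per step of the trace map.
  have hs : ∀ n, x n + y n + z n ≤ (2 / 3) ^ n * (x 0 + y 0 + z 0) := fun n => by
    induction n with
    | zero => simp
    | succ n ih =>
      have p1 := h.pos₁ (n + 1)
      have p2 := h.pos₂ (n + 1)
      have p3 := h.pos₃ (n + 1)
      have e1 : 0 ≤ y (n + 1) * z (n + 1) / (2 * (x (n + 1) + y (n + 1) + z (n + 1))) := by
        positivity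
      have e2 : 0 ≤ z (n + 1) * x (n + 1) / (2 * (x (n + 1) + y (n + 1) + z (n + 1))) := by
        positivity
      have e3 : 0 ≤ x (n + 1) * y (n + 1) / (2 * (x (n + 1) + y (n + 1) + z (n + 1))) := by
        positivity
      have := h.step₁ n
      have := h.step₂ n
      have := h.step₃ n
      rw [pow_succ]
      linarith
  have hd : ∀ n, (3 / 4) ^ n * |y 0 - z 0| ≤ |y n - z n| := fun n => by
    induction n with
    | zero => simp
    | succ n ih =>
      have p1 := h.pos₁ (n + 1)
      have p2 := h.pos₂ (n + 1)
      have p3 := h.pos₃ (n + 1)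
      have q1 := hy (n + 1)
      have q2 := hz (n + 1)
      have hf := h.rotate.sub_factor_pos n
      have e := h.rotate.sub_eq n
      have hle : 3 / 2 - x (n + 1) / (2 * (y (n + 1) + z (n + 1) + x (n + 1))) ≤ 4 / 3 := by
        -- The largest resistance is at least a third of the sum.
        have : 1 / 6 ≤ x (n + 1) / (2 * (y (n + 1) + z (n + 1) + x (n + 1))) := by
          rw [le_div_iff₀ (by positivity)]
          linarith
        linarith
      rw [e, abs_mul, abs_of_pos hf] at ih
      have := mul_le_mul_of_nonneg_right hle (abs_nonneg (y (n + 1) - z (n + 1)))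
      rw [pow_succ]
      linarith
  have hlim : Tendsto (fun n : ℕ => (8 / 9 : ℝ) ^ n * (x 0 + y 0 + z 0)) atTop
      (𝓝 (0 * (x 0 + y 0 + z 0))) :=
    (tendsto_pow_atTop_nhds_zero_of_lt_one (by norm_num) (by norm_num)).mul_const _
  rw [zero_mul] at hlim
  have hfin : |y 0 - z 0| ≤ 0 := by
    refine ge_of_tendsto' hlim fun n => ?_
    have hab : |y n - z n| ≤ x n + y n + z n := by
      have p1 := h.pos₁ n
      have p2 := h.pos₂ n
      have p3 := h.pos₃ n
      rw [abs_le]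
      constructor <;> linarith
    have h4 : (0 : ℝ) < (3 / 4) ^ n := by positivity
    have := (hd n).trans (hab.trans (hs n))
    -- The two decay rates differ by the factor `8/9 < 1`, whose powers force the difference to
    -- zero.
    rw [show (2 / 3 : ℝ) = 3 / 4 * (8 / 9) by norm_num, mul_pow, mul_assoc] at this
    exact le_of_mul_le_mul_left this h4
  have := abs_nonpos_iff.1 hfin
  linarith

lemma eq (h : IsStarOrbit x y z) (h1 : y 0 ≤ x 0) (h2 : z 0 ≤ x 0) (n : ℕ) : y n = z n := by
  have h3 : z 0 = y 0 := (h.eq_zero h1 h2).symm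
  have hz : z n ≤ y n := h.rotate.le_of_le h3.le n
  have := (h.shift n).eq_zero (by simpa using h.le_of_le h1 n)
    (by simpa using hz.trans (h.le_of_le h1 n))
  simpa using this

end IsStarOrbit

/-! ### Inverting the trace map -/

/-- The trace map is injective on the pairs of resistances that are admissible at every level. -/
lemma eq_of_trace_eq {x y x' y' : ℝ} (hx : 0 < x) (hy : 0 < y) (hx' : 0 < x') (hy' : 0 < y')
    (h1 : 3 / 2 * x + y * y / (2 * (x + y + y)) = 3 / 2 * x' + y' * y' / (2 * (x' + y' + y')))
    (h2 : 3 / 2 * y + y * x / (2 * (x + y + y)) = 3 / 2 * y' + y' * x' / (2 * (x' + y' + y'))) :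
    x = x' ∧ y = y' := by
  have a1 : 3 / 2 * x + y * y / (2 * (x + y + y)) =
      (3 * x ^ 2 + 6 * x * y + y ^ 2) / (2 * (x + y + y)) := by field_simp; ring
  have a2 : 3 / 2 * y + y * x / (2 * (x + y + y)) =
      (4 * x * y + 6 * y ^ 2) / (2 * (x + y + y)) := by field_simp; ring
  have a3 : 3 / 2 * x' + y' * y' / (2 * (x' + y' + y')) =
      (3 * x' ^ 2 + 6 * x' * y' + y' ^ 2) / (2 * (x' + y' + y')) := by field_simp; ring
  have a4 : 3 / 2 * y' + y' * x' / (2 * (x' + y' + y')) =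
      (4 * x' * y' + 6 * y' ^ 2) / (2 * (x' + y' + y')) := by field_simp; ring
  have h1' := h1
  rw [a1, a3, div_eq_div_iff (by positivity) (by positivity)] at h1
  rw [a2, a4, div_eq_div_iff (by positivity) (by positivity)] at h2
  have hcross : (3 * x ^ 2 + 6 * x * y + y ^ 2) * (4 * x' * y' + 6 * y' ^ 2) =
      (3 * x' ^ 2 + 6 * x' * y' + y' ^ 2) * (4 * x * y + 6 * y ^ 2) := by
    have hs : 2 * (x + y + y) * (2 * (x' + y' + y')) ≠ 0 := by positivity
    apply mul_right_cancel₀ hs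
    linear_combination (2 * (x + y + y)) * (4 * x' * y' + 6 * y' ^ 2) * h1 -
      (2 * (x + y + y)) * (3 * x' ^ 2 + 6 * x' * y' + y' ^ 2) * h2
  -- The image ratio determines `y / x`: the cross-multiplied equation factors, and the second
  -- factor is positive.
  have hfac : (x * y' - x' * y) *
      (32 * y * y' + 12 * x * x' + 18 * (y * x' + x * y')) = 0 := by
    linear_combination hcross
  have hxy : x * y' = x' * y := by
    rcases mul_eq_zero.1 hfac with h | h
    · linarith
    · have : 0 < 32 * y * y' + 12 * x * x' + 18 * (y * x' + x * y') := by positivity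
      linarith
  obtain ⟨t, ht⟩ : ∃ t, t = y / x := ⟨_, rfl⟩
  have ht0 : 0 < t := by rw [ht]; positivity
  have e1 : y = t * x := by rw [ht]; field_simp
  have e2 : y' = t * x' := by rw [ht]; field_simp; linarith
  -- With the ratio `t` fixed, the trace map is linear in the scale.
  have hscale : ∀ w : ℝ, 0 < w → 3 / 2 * w + t * w * (t * w) / (2 * (w + t * w + t * w)) =
      (3 / 2 + t * t / (2 * (1 + t + t))) * w := by
    intro w hw
    field_simp
  rw [e1, e2, hscale x hx, hscale x' hx'] at h1'
  have hxx : x = x' := mul_left_cancel₀ (by positivity) h1'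
  exact ⟨hxx, by rw [e1, e2, hxx]⟩

/-- The trace map is onto the pairs of resistances with the correct order. -/
lemma exists_trace_eq {X Y : ℝ} (hY : 0 < Y) (hXY : Y ≤ X) : ∃ x y : ℝ, 0 < y ∧ y ≤ x ∧
    X = 3 / 2 * x + y * y / (2 * (x + y + y)) ∧ Y = 3 / 2 * y + y * x / (2 * (x + y + y)) := by
  have hX : 0 < X := hY.trans_le hXY
  -- The unknown is `t = y / x`. The polynomial equals `-3Y < 0` at `0` and `10(X - Y) ≥ 0` at `1`.
  have hcont : ContinuousOn (fun t : ℝ => X * (4 * t + 6 * t ^ 2) - Y * (3 + 6 * t + t ^ 2))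
      (Icc 0 1) := by fun_prop
  obtain ⟨t, ⟨ht0, ht1⟩, ht⟩ := intermediate_value_Icc (zero_le_one' ℝ) hcont
    (show (0 : ℝ) ∈ Icc _ _ by constructor <;> norm_num <;> linarith)
  simp only at ht
  have ht' : 0 < t := by
    refine lt_of_le_of_ne ht0 fun h => ?_
    rw [← h] at ht
    norm_num at ht
    linarith
  obtain ⟨x, hx⟩ : ∃ x, x = X / (3 / 2 + t * t / (2 * (1 + t + t))) := ⟨_, rfl⟩
  have hx0 : 0 < x := by rw [hx]; positivity
  have hXx : X = (3 / 2 + t * t / (2 * (1 + t + t))) * x := by rw [hx]; field_simp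
  refine ⟨x, t * x, by positivity, by nlinarith, ?_, ?_⟩
  · rw [hXx]; field_simp
  · have hpos : 3 + 6 * t + t ^ 2 ≠ 0 := by positivity
    apply mul_right_cancel₀ hpos
    have : Y * (3 + 6 * t + t ^ 2) = X * (4 * t + 6 * t ^ 2) := by linarith
    rw [this, hXx]
    field_simp
    ring

lemma exists_isStarOrbit {X Y : ℝ} (hY : 0 < Y) (hXY : Y ≤ X) :
    ∃ x y : ℕ → ℝ, x 0 = X ∧ y 0 = Y ∧ IsStarOrbit x y y := by
  have hstep : ∀ p : {p : ℝ × ℝ // 0 < p.2 ∧ p.2 ≤ p.1}, ∃ q : {p : ℝ × ℝ // 0 < p.2 ∧ p.2 ≤ p.1},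
      p.1.1 = 3 / 2 * q.1.1 + q.1.2 * q.1.2 / (2 * (q.1.1 + q.1.2 + q.1.2)) ∧
      p.1.2 = 3 / 2 * q.1.2 + q.1.2 * q.1.1 / (2 * (q.1.1 + q.1.2 + q.1.2)) := by
    intro p
    obtain ⟨x, y, h1, h2, h3, h4⟩ := exists_trace_eq p.2.1 p.2.2
    exact ⟨⟨(x, y), h1, h2⟩, h3, h4⟩
  choose g hg using hstep
  let s : ℕ → {p : ℝ × ℝ // 0 < p.2 ∧ p.2 ≤ p.1} := fun n => g^[n] ⟨(X, Y), hY, hXY⟩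
  have hs : ∀ n, s (n + 1) = g (s n) := fun n => Function.iterate_succ_apply' g n _
  refine ⟨fun n => (s n).1.1, fun n => (s n).1.2, rfl, rfl, ?_, ?_, ?_, ?_, ?_, ?_⟩
  · exact fun n => (s n).2.1.trans_le (s n).2.2
  · exact fun n => (s n).2.1
  · exact fun n => (s n).2.1
  · intro n; rw [hs]; exact (hg (s n)).1
  · intro n; rw [hs]; exact (hg (s n)).2
  · intro n; rw [hs, mul_comm (g (s n)).1.1]; exact (hg (s n)).2

/-! ### Decay rates of the resistances -/

namespace IsStarOrbit

variable {x y : ℕ → ℝ}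

/-- The sequence `x n * (3/2)^n` is nonincreasing, and `(x n - y n) * (3/2)^n` is nondecreasing
because the multiplier in `sub_eq` is at most `3/2`. -/
lemma bound_one (h : IsStarOrbit x y y) (h0 : y 0 < x 0) (n : ℕ) :
    x 0 - y 0 ≤ x n * (3 / 2) ^ n ∧ x n * (3 / 2) ^ n ≤ x 0 := by
  constructor
  · suffices H : x 0 - y 0 ≤ (x n - y n) * (3 / 2) ^ n by
      have := mul_pos (h.pos₂ n) (show (0 : ℝ) < (3 / 2) ^ n by positivity)
      linarith
    induction n with
    | zero => simp
    | succ n ih =>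
      refine ih.trans ?_
      have p1 := h.pos₁ (n + 1)
      have p2 := h.pos₂ (n + 1)
      have hd := sub_pos.2 (h.lt_of_lt h0 (n + 1))
      rw [pow_succ', ← mul_assoc, h.sub_eq n]
      refine mul_le_mul_of_nonneg_right ?_ (by positivity)
      rw [mul_comm]
      refine mul_le_mul_of_nonneg_left ?_ hd.le
      have : 0 ≤ y (n + 1) / (2 * (x (n + 1) + y (n + 1) + y (n + 1))) := by positivity
      linarith
  · induction n with
    | zero => simp
    | succ n ih =>
      refine le_trans ?_ ih
      have p1 := h.pos₁ (n + 1)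
      have p2 := h.pos₂ (n + 1)
      rw [pow_succ', ← mul_assoc, h.step₁ n]
      refine mul_le_mul_of_nonneg_right ?_ (by positivity)
      have : 0 ≤ y (n + 1) * y (n + 1) / (2 * (x (n + 1) + y (n + 1) + y (n + 1))) := by positivity
      linarith

/-- `y n * 2^n` is nondecreasing; multiplied by `(x n / (x n - y n))^2` it becomes nonincreasing.
For small `t = y / x`, a step of the trace map multiplies `y` by about `2(1 - t/2)` and `x / (x -
y)` by about `1 + t/3`, so the square more than makes up for the loss. -/
lemma bound_two (h : IsStarOrbit x y y) (h0 : y 0 < x 0) (n : ℕ) :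
    y 0 ≤ y n * 2 ^ n ∧ y n * 2 ^ n ≤ y 0 * (x 0 / (x 0 - y 0)) ^ 2 := by
  constructor
  · induction n with
    | zero => simp
    | succ n ih =>
      refine ih.trans ?_
      have p1 := h.pos₁ (n + 1)
      have p2 := h.pos₂ (n + 1)
      rw [pow_succ', ← mul_assoc, h.step₂ n]
      refine mul_le_mul_of_nonneg_right ?_ (by positivity)
      have : y (n + 1) * x (n + 1) / (2 * (x (n + 1) + y (n + 1) + y (n + 1))) ≤
          1 / 2 * y (n + 1) := by
        rw [div_le_iff₀ (by positivity)]
        nlinarith [mul_pos p2 p2]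
      linarith
  · suffices H : y n * 2 ^ n * (x n / (x n - y n)) ^ 2 ≤ y 0 * (x 0 / (x 0 - y 0)) ^ 2 by
      refine le_trans ?_ H
      have hd := sub_pos.2 (h.lt_of_lt h0 n)
      have p2 := h.pos₂ n
      refine le_mul_of_one_le_right (by positivity) (one_le_pow₀ ?_)
      rw [le_div_iff₀ hd]
      linarith
    induction n with
    | zero => simp
    | succ n ih =>
      refine le_trans ?_ ih
      have p1 := h.pos₁ (n + 1)
      have p2 := h.pos₂ (n + 1)
      have hd := sub_pos.2 (h.lt_of_lt h0 (n + 1))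
      rw [h.sub_eq n, h.step₁ n, h.step₂ n]
      generalize x (n + 1) = a at *
      generalize y (n + 1) = b at *
      have hs : 0 < a + b + b := by positivity
      have e1 : 3 / 2 * a + b * b / (2 * (a + b + b)) =
          (3 * a ^ 2 + 6 * a * b + b ^ 2) / (2 * (a + b + b)) := by field_simp; ring
      have e2 : 3 / 2 * b + b * a / (2 * (a + b + b)) =
          b * (4 * a + 6 * b) / (2 * (a + b + b)) := by field_simp; ring
      have e3 : 3 / 2 - b / (2 * (a + b + b)) = (3 * a + 5 * b) / (2 * (a + b + b)) := by
        field_simp; ring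
      have e4 : (3 * a ^ 2 + 6 * a * b + b ^ 2) / (2 * (a + b + b)) /
          ((3 * a + 5 * b) / (2 * (a + b + b)) * (a - b)) =
          (3 * a ^ 2 + 6 * a * b + b ^ 2) / (a * (3 * a + 5 * b)) * (a / (a - b)) := by
        field_simp
      rw [e1, e2, e3, e4, mul_pow, ← mul_assoc]
      refine mul_le_mul_of_nonneg_right ?_ (by positivity)
      have e5 : b * (4 * a + 6 * b) / (2 * (a + b + b)) * 2 ^ n *
          ((3 * a ^ 2 + 6 * a * b + b ^ 2) / (a * (3 * a + 5 * b))) ^ 2 =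
          b * 2 ^ n * ((4 * a + 6 * b) / (2 * (a + b + b)) *
          ((3 * a ^ 2 + 6 * a * b + b ^ 2) / (a * (3 * a + 5 * b))) ^ 2) := by ring
      rw [e5, pow_succ, ← mul_assoc]
      refine mul_le_mul_of_nonneg_left ?_ (by positivity)
      -- Bernoulli's inequality suffices: with this lower bound for the square, the remaining claim
      -- `2 ≤ ...` is a comparison of quadratic polynomials.
      have e6 : 1 + 2 * (b / (3 * a + 5 * b)) ≤
          ((3 * a ^ 2 + 6 * a * b + b ^ 2) / (a * (3 * a + 5 * b))) ^ 2 := by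
        have e7 : (3 * a ^ 2 + 6 * a * b + b ^ 2) / (a * (3 * a + 5 * b)) =
            1 + b / (3 * a + 5 * b) + b ^ 2 / (a * (3 * a + 5 * b)) := by field_simp; ring
        rw [e7]
        have n1 : 0 ≤ b / (3 * a + 5 * b) := by positivity
        have n2 : 0 ≤ b ^ 2 / (a * (3 * a + 5 * b)) := by positivity
        nlinarith [mul_nonneg n1 n2, mul_nonneg n2 n2, mul_nonneg n1 n1]
      refine le_trans ?_ (mul_le_mul_of_nonneg_left e6 (by positivity))
      have e8 : (4 * a + 6 * b) / (2 * (a + b + b)) * (1 + 2 * (b / (3 * a + 5 * b))) =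
          (4 * a + 6 * b) * (3 * a + 7 * b) / (2 * (a + b + b) * (3 * a + 5 * b)) := by
        field_simp; ring
      rw [e8, le_div_iff₀ (by positivity)]
      nlinarith [mul_pos p1 p2, mul_pos p2 p2]

end IsStarOrbit

/-! ### Cyclic indices and the edges of `levelGraph` -/

lemma fin_three_add : ∀ i : Fin 3, i + 1 + 1 = i + 2 ∧ i + 1 + 2 = i ∧ i + 2 + 1 = i ∧
    i + 2 + 2 = i + 1 := by decide

lemma add_rotate (f : Fin 3 → ℝ) (i : Fin 3) :
    f 0 + f 1 + f 2 = f i + f (i + 1) + f (i + 2) := by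
  fin_cases i <;> simp <;> ring

lemma mul_add_rotate (f : Fin 3 → ℝ) (i : Fin 3) :
    f 0 * f 1 + f 1 * f 2 + f 2 * f 0 =
      f i * f (i + 1) + f (i + 1) * f (i + 2) + f (i + 2) * f i := by
  fin_cases i <;> simp <;> ring

/-- Two cells share at most one point, so each edge belongs to a single cell. This turns the sum
over edges into a sum over words and sides. -/
lemma edge_injective (n : ℕ) : Function.Injective fun p : (Fin n → Fin 3) × Fin 3 =>
    s(wordMap n p.1 (vert (p.2 + 1)), wordMap n p.1 (vert (p.2 + 2))) := by
  induction n with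
  | zero =>
    rintro ⟨ω, i⟩ ⟨ω', i'⟩ h
    have hf : ∀ i i' : Fin 3, (i + 1 = i' + 1 ∧ i + 2 = i' + 2 ∨ i + 1 = i' + 2 ∧ i + 2 = i' + 1) →
        i = i' := by decide
    simp only [wordMap, id, Sym2.eq_iff, vert_injective.eq_iff] at h
    rw [hf i i' h, Subsingleton.elim ω ω']
  | succ n ih =>
    rintro ⟨ω, i⟩ ⟨ω', i'⟩ h
    have h' : Sym2.map (cellMap (ω 0)) s(wordMap n (Fin.tail ω) (vert (i + 1)),
        wordMap n (Fin.tail ω) (vert (i + 2))) = Sym2.map (cellMap (ω' 0))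
        s(wordMap n (Fin.tail ω') (vert (i' + 1)), wordMap n (Fin.tail ω') (vert (i' + 2))) := h
    by_cases h0 : ω 0 = ω' 0
    · rw [h0] at h'
      have := ih (a₁ := (Fin.tail ω, i)) (a₂ := (Fin.tail ω', i'))
        (Sym2.map.injective (cellMap_injective _) h')
      rw [Prod.mk.injEq] at this
      rw [← Fin.cons_self_tail ω, ← Fin.cons_self_tail ω', h0, this.1, this.2]
    · exfalso
      have key : wordMap n (Fin.tail ω) (vert (i + 1)) = wordMap n (Fin.tail ω) (vert (i + 2)) := by
        rw [Sym2.map_mk, Sym2.map_mk, Sym2.eq_iff] at h'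
        rcases h' with ⟨h1, h2⟩ | ⟨h1, h2⟩ <;>
        exact (eq_vert_of_cellMap_eq h0 h1).trans (eq_vert_of_cellMap_eq h0 h2).symm
      have := vert_injective (wordMap_injective _ _ key)
      revert this
      fin_cases i <;> decide

lemma edgeSet_levelGraph (n : ℕ) : (levelGraph n).edgeSet =
    range fun p : (Fin n → Fin 3) × Fin 3 =>
      s(wordMap n p.1 (vert (p.2 + 1)), wordMap n p.1 (vert (p.2 + 2))) := by
  ext e
  induction e using Sym2.ind with
  | _ x y =>
  rw [SimpleGraph.mem_edgeSet]
  constructor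
  · rintro ⟨hne, ω, ⟨_, ⟨j, rfl⟩, rfl⟩, ⟨_, ⟨k, rfl⟩, rfl⟩⟩
    have hjk : j ≠ k := by rintro rfl; exact hne rfl
    have hf : ∀ j k : Fin 3, j ≠ k →
        (-(j + k) + 1 = j ∧ -(j + k) + 2 = k ∨ -(j + k) + 1 = k ∧ -(j + k) + 2 = j) := by decide
    refine ⟨(ω, -(j + k)), ?_⟩
    rcases hf j k hjk with ⟨h1, h2⟩ | ⟨h1, h2⟩
    · simp only [h1, h2]
    · simp only [h1, h2, Sym2.eq_swap]
  · rintro ⟨⟨ω, i⟩, h⟩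
    have hf : ∀ i : Fin 3, i + 1 ≠ i + 2 := by decide
    have hadj : (levelGraph n).Adj (wordMap n ω (vert (i + 1))) (wordMap n ω (vert (i + 2))) :=
      ⟨fun h => hf i (vert_injective (wordMap_injective _ _ h)), ω,
        ⟨_, ⟨_, rfl⟩, rfl⟩, ⟨_, ⟨_, rfl⟩, rfl⟩⟩
    rw [← SimpleGraph.mem_edgeSet] at hadj ⊢
    rw [← h]
    exact hadj

lemma stdLevelEnergy_eq (n : ℕ) (u : SG → ℝ) :
    stdLevelEnergy n u = (5 / 3) ^ n * levelEnergy n (fun _ => 1) u := by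
  rw [stdLevelEnergy, edgeSet_levelGraph, finsum_mem_range (edge_injective n),
    finsum_eq_sum_of_fintype, Fintype.sum_prod_type]
  simp only [levelEnergy, one_mul]
  rfl

/-! ### From resistances back to conductances: bounds, classification, existence -/

/-- For `y ≤ x` the quotient lies between `1 / (3y)` and `1 / y`, and `P` is comparable to `1 / y`.
-/
lemma conductance_bounds₁ {x y P Y B : ℝ} (hx : 0 < x) (hy : 0 < y) (hyx : y ≤ x) (hP : 0 < P)
    (hY : 0 < Y) (h1 : Y ≤ y * P) (h2 : y * P ≤ B) :
    x / (y * (2 * x + y)) ≤ (3 * B + 1 / Y) * P ∧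
      P ≤ (3 * B + 1 / Y) * (x / (y * (2 * x + y))) := by
  have hB : 0 < B := by linarith
  constructor
  · calc x / (y * (2 * x + y)) ≤ 1 / y := by
          rw [div_le_div_iff₀ (by positivity) hy]; nlinarith
      _ ≤ 1 / Y * P := by
          rw [one_div_mul_eq_div, div_le_div_iff₀ hy hY]; linarith
      _ ≤ (3 * B + 1 / Y) * P := by gcongr; linarith
  · calc P ≤ 3 * B * (x / (y * (2 * x + y))) := by
          rw [← mul_div_assoc, le_div_iff₀ (by positivity)]
          calc P * (y * (2 * x + y)) = y * P * (2 * x + y) := by ring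
            _ ≤ B * (3 * x) := by gcongr; linarith
            _ = 3 * B * x := by ring
      _ ≤ (3 * B + 1 / Y) * (x / (y * (2 * x + y))) := by
          gcongr
          have : 0 < 1 / Y := by positivity
          linarith

/-- The quotient is `1 / (2x + y)`, which lies between `1 / (3x)` and `1 / x`. -/
lemma conductance_bounds₂ {x y Q A X : ℝ} (hx : 0 < x) (hy : 0 < y) (hyx : y ≤ x) (hQ : 0 < Q)
    (hA : 0 < A) (h1 : A ≤ x * Q) (h2 : x * Q ≤ X) :
    y / (y * (2 * x + y)) ≤ (3 * X + 1 / A) * Q ∧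
      Q ≤ (3 * X + 1 / A) * (y / (y * (2 * x + y))) := by
  have hX : 0 < X := by linarith
  have e : y / (y * (2 * x + y)) = 1 / (2 * x + y) := by field_simp
  rw [e]
  constructor
  · calc 1 / (2 * x + y) ≤ 1 / x := one_div_le_one_div_of_le hx (by linarith)
      _ ≤ 1 / A * Q := by
          rw [one_div_mul_eq_div, div_le_div_iff₀ hx hA]; linarith
      _ ≤ (3 * X + 1 / A) * Q := by gcongr; linarith
  · calc Q ≤ 3 * X * (1 / (2 * x + y)) := by
          rw [mul_one_div, le_div_iff₀ (by positivity)]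
          nlinarith
      _ ≤ (3 * X + 1 / A) * (1 / (2 * x + y)) := by
          gcongr
          have : 0 < 1 / A := by positivity
          linarith

namespace IsRecursiveConstruction

variable {c₀ : Fin 3 → ℝ} {c : ℕ → Fin 3 → ℝ}

lemma isStarOrbit (h : IsRecursiveConstruction c₀ c) (i : Fin 3) :
    IsStarOrbit (fun n => star (c n) i) (fun n => star (c n) (i + 1))
      (fun n => star (c n) (i + 2)) := by
  obtain ⟨-, hpos, hc⟩ := isRecursiveConstruction_iff.1 h
  have hs : ∀ n j, star (c n) j = 3 / 2 * star (c (n + 1)) j +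
      star (c (n + 1)) (j + 1) * star (c (n + 1)) (j + 2) / (2 * (star (c (n + 1)) i +
        star (c (n + 1)) (i + 1) + star (c (n + 1)) (i + 2))) := by
    intro n j
    rw [← add_rotate]
    exact congrFun (hc n) j
  obtain ⟨h11, h12, h21, h22⟩ := fin_three_add i
  refine ⟨fun n => star_pos (hpos n) _, fun n => star_pos (hpos n) _,
    fun n => star_pos (hpos n) _, fun n => hs n i, fun n => ?_, fun n => ?_⟩
  · have := hs n (i + 1)
    rwa [h11, h12] at this
  · have := hs n (i + 2)
    rwa [h21, h22] at this

end IsRecursiveConstruction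

/-- The transform divides all entries by one positive number, so conductances and star resistances
are ordered alike. -/
lemma star_le_star {c : Fin 3 → ℝ} (hc : ∀ i, 0 < c i) {i j : Fin 3} :
    star c i ≤ star c j ↔ c i ≤ c j := by
  have := hc 0; have := hc 1; have := hc 2
  exact div_le_div_iff_of_pos_right (by positivity)

namespace IsRecursiveConstruction

variable {c₀ : Fin 3 → ℝ} {c : ℕ → Fin 3 → ℝ}

/-- If the conductance `c₀ i` is maximal, then the other two conductances agree at every level. -/
lemma conductance_eq (h : IsRecursiveConstruction c₀ c) {i : Fin 3} (h1 : c₀ (i + 1) ≤ c₀ i)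
    (h2 : c₀ (i + 2) ≤ c₀ i) (n : ℕ) : star (c n) (i + 1) = star (c n) (i + 2) := by
  have h0 := h.init
  subst h0
  exact (h.isStarOrbit i).eq ((star_le_star (h.pos 0)).2 h1) ((star_le_star (h.pos 0)).2 h2) n

lemma conductance_init_eq (h : IsRecursiveConstruction c₀ c) {i : Fin 3} (h1 : c₀ (i + 1) ≤ c₀ i)
    (h2 : c₀ (i + 2) ≤ c₀ i) : c₀ (i + 1) = c₀ (i + 2) := by
  have h3 := h.conductance_eq h1 h2 0
  have h0 := h.init
  subst h0
  exact le_antisymm ((star_le_star (h.pos 0)).1 h3.le) ((star_le_star (h.pos 0)).1 h3.ge)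

lemma cases (h : IsRecursiveConstruction c₀ c) :
    (∀ i j, c₀ i = c₀ j) ∨ ∃ i, c₀ (i + 1) = c₀ (i + 2) ∧ c₀ (i + 1) < c₀ i := by
  obtain ⟨i, hi⟩ := Finite.exists_max c₀
  have h1 := h.conductance_init_eq (hi (i + 1)) (hi (i + 2))
  rcases (hi (i + 1)).lt_or_eq with hlt | heq
  · exact Or.inr ⟨i, h1, hlt⟩
  · refine Or.inl ?_
    have hall : ∀ j, c₀ j = c₀ i := fun j => by
      rcases fin_three_cases j i with rfl | rfl | rfl
      · rfl
      · exact heq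
      · rw [← h1, heq]
    exact fun j k => (hall j).trans (hall k).symm

/-- A maximal entry of `c₀` singles out the same equal pair in both sequences at every level, so
`eq_of_trace_eq` applies inductively. -/
lemma unique {c' : ℕ → Fin 3 → ℝ} (h : IsRecursiveConstruction c₀ c)
    (h' : IsRecursiveConstruction c₀ c') : c = c' := by
  obtain ⟨i, hi⟩ := Finite.exists_max c₀
  have e := h.conductance_eq (hi _) (hi _)
  have e' := h'.conductance_eq (hi _) (hi _)
  have o := h.isStarOrbit i
  have o' := h'.isStarOrbit i
  funext n
  induction n with
  | zero => rw [h.init, h'.init]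
  | succ n ih =>
    have s1 := o.step₁ n
    have s2 := o.step₂ n
    have s1' := o'.step₁ n
    have s2' := o'.step₂ n
    simp only [← e, ← e'] at s1 s2 s1' s2'
    rw [ih] at s1 s2
    obtain ⟨hx, hy⟩ := eq_of_trace_eq (o.pos₁ (n + 1)) (o.pos₂ (n + 1)) (o'.pos₁ (n + 1))
      (o'.pos₂ (n + 1)) (s1.symm.trans s1') (s2.symm.trans s2')
    rw [← star_star (h.pos (n + 1)), ← star_star (h'.pos (n + 1))]
    congr 1
    funext j
    rcases fin_three_cases j i with rfl | rfl | rfl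
    · exact hx
    · exact hy
    · rw [← e, ← e']; exact hy

end IsRecursiveConstruction

lemma exists_isRecursiveConstruction {c₀ : Fin 3 → ℝ} (hc₀ : ∀ i, 0 < c₀ i) {i : Fin 3}
    (h1 : c₀ (i + 1) = c₀ (i + 2)) (h2 : c₀ (i + 1) ≤ c₀ i) :
    ∃ c, IsRecursiveConstruction c₀ c := by
  obtain ⟨x, y, hx0, hy0, o⟩ := exists_isStarOrbit (star_pos hc₀ (i + 1)) ((star_le_star hc₀).2 h2)
  let s : ℕ → Fin 3 → ℝ := fun n j => if j = i then x n else y n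
  have hi : ∀ i : Fin 3, i + 1 ≠ i ∧ i + 2 ≠ i := by decide
  have s0 : ∀ n, s n i = x n := fun n => if_pos rfl
  have s1 : ∀ n, s n (i + 1) = y n := fun n => if_neg (hi i).1
  have s2 : ∀ n, s n (i + 2) = y n := fun n => if_neg (hi i).2
  have hs : ∀ n j, 0 < s n j := fun n j => by
    simp only [s]
    split_ifs
    exacts [o.pos₁ n, o.pos₂ n]
  refine ⟨fun n => star (s n), isRecursiveConstruction_iff.2
    ⟨?_, fun n => star_pos (hs n), fun n => ?_⟩⟩
  · have : s 0 = star c₀ := by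
      funext j
      rcases fin_three_cases j i with rfl | rfl | rfl
      · rw [s0, hx0]
      · rw [s1, hy0]
      · rw [s2, hy0, star, star, h1]
    rw [this, star_star hc₀]
  · rw [star_star (hs n), star_star (hs (n + 1))]
    obtain ⟨h11, h12, h21, h22⟩ := fin_three_add i
    funext j
    rw [traceStar, add_rotate _ i, s0, s1, s2]
    rcases fin_three_cases j i with rfl | rfl | rfl
    · rw [s0, s0, s1, s2]; exact o.step₁ n
    · rw [h11, h12, s0, s1, s1, s2]; exact o.step₂ n
    · rw [h21, h22, s0, s1, s2, s2]; exact o.step₃ n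

/-! ### Limit energies -/

namespace IsRecursiveConstruction

variable {c₀ : Fin 3 → ℝ} {c : ℕ → Fin 3 → ℝ}

/-- The function `u` is itself a competitor in the minimum that defines the trace. -/
lemma levelEnergy_monotone (h : IsRecursiveConstruction c₀ c) (u : SG → ℝ) :
    Monotone fun n => ENNReal.ofReal (levelEnergy n (c n) u) :=
  monotone_nat_of_le_succ fun n =>
    ENNReal.ofReal_le_ofReal ((h.compatible n u).2 ⟨u, fun _ _ => rfl, rfl⟩)

lemma tendsto_iSup (h : IsRecursiveConstruction c₀ c) (u : SG → ℝ) :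
    Tendsto (fun n => ENNReal.ofReal (levelEnergy n (c n) u)) atTop
      (𝓝 (⨆ n, ENNReal.ofReal (levelEnergy n (c n) u))) :=
  tendsto_atTop_iSup (h.levelEnergy_monotone u)

lemma energy_eq_iSup (h : IsRecursiveConstruction c₀ c) (u : SG → ℝ) :
    energy c u = ⨆ n, ENNReal.ofReal (levelEnergy n (c n) u) :=
  (h.tendsto_iSup u).limUnder_eq

lemma tendsto_energy (h : IsRecursiveConstruction c₀ c) (u : SG → ℝ) :
    Tendsto (fun n => ENNReal.ofReal (levelEnergy n (c n) u)) atTop (𝓝 (energy c u)) := by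
  rw [h.energy_eq_iSup]
  exact h.tendsto_iSup u

/-- Every index is maximal, so all star resistances agree at each level. The trace map then
multiplies them by `3/2 + 1/6 = 5/3`, and the conductances are `1 / (3x)`. -/
lemma conductance_of_isotropic (h : IsRecursiveConstruction c₀ c) (hc : ∀ i j, c₀ i = c₀ j)
    (n : ℕ) (i : Fin 3) : c n i = (5 / 3) ^ n * c₀ 0 := by
  have hs : ∀ n i, star (c n) i = star (c n) 0 := by
    intro n
    have h0 := h.conductance_eq (hc (0 + 1) 0).le (hc (0 + 2) 0).le n
    have h1 := h.conductance_eq (hc (1 + 1) 1).le (hc (1 + 2) 1).le n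
    simp only [Fin.isValue, Fin.reduceAdd] at h0 h1
    intro i
    fin_cases i
    · rfl
    · exact h0.trans h1
    · exact h1
  have hcn : ∀ n i, c n i = 1 / (3 * star (c n) 0) := by
    intro n i
    have hp := star_pos (h.pos n) 0
    conv_lhs => rw [← star_star (h.pos n)]
    rw [star, hs n i, hs n 1, hs n 2]
    field_simp
    norm_num
  have hstep : ∀ n, star (c n) 0 = 5 / 3 * star (c (n + 1)) 0 := by
    intro n
    have hp := star_pos (h.pos (n + 1)) 0
    have := (h.isStarOrbit 0).step₁ n
    simp only [hs (n + 1) (0 + 1), hs (n + 1) (0 + 2)] at this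
    rw [this]
    field_simp
    norm_num
  rw [hcn n i]
  induction n with
  | zero => rw [← hcn 0 0, h.init]; simp
  | succ n ih =>
    have hp := star_pos (h.pos (n + 1)) 0
    rw [hstep n] at ih
    rw [pow_succ', mul_assoc, ← ih]
    field_simp

lemma levelEnergy_of_isotropic (h : IsRecursiveConstruction c₀ c) (hc : ∀ i j, c₀ i = c₀ j)
    (n : ℕ) (u : SG → ℝ) : levelEnergy n (c n) u = c₀ 0 * stdLevelEnergy n u := by
  have hcn : c n = fun i => (c₀ 0 * (5 / 3) ^ n) * (fun _ => 1 : Fin 3 → ℝ) i := by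
    funext i
    rw [h.conductance_of_isotropic hc]
    ring
  rw [hcn, levelEnergy_smul, stdLevelEnergy_eq, mul_assoc]

/-- Convergence is inherited from the level energies of `c`, which differ by the constant factor `c₀
0`; only then does `limUnder` denote the limit. -/
lemma tendsto_stdEnergy (h : IsRecursiveConstruction c₀ c) (hc₀ : 0 < c₀ 0)
    (hc : ∀ i j, c₀ i = c₀ j) (u : SG → ℝ) :
    Tendsto (fun n => ENNReal.ofReal (stdLevelEnergy n u)) atTop (𝓝 (stdEnergy u)) := by
  have ht : Tendsto (fun n => ENNReal.ofReal (stdLevelEnergy n u)) atTop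
      (𝓝 (ENNReal.ofReal (c₀ 0)⁻¹ * energy c u)) := by
    refine (ENNReal.Tendsto.const_mul (h.tendsto_energy u)
      (Or.inr ENNReal.ofReal_ne_top)).congr fun n => ?_
    rw [← ENNReal.ofReal_mul (by positivity), h.levelEnergy_of_isotropic hc,
      inv_mul_cancel_left₀ hc₀.ne']
  rw [stdEnergy, ht.limUnder_eq]
  exact ht

lemma energy_eq_stdEnergy (h : IsRecursiveConstruction c₀ c) (hc₀ : 0 < c₀ 0)
    (hc : ∀ i j, c₀ i = c₀ j) (u : SG → ℝ) :
    energy c u = ENNReal.ofReal (c₀ 0) * stdEnergy u := by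
  refine tendsto_nhds_unique (h.tendsto_energy u) ?_
  refine (ENNReal.Tendsto.const_mul (h.tendsto_stdEnergy hc₀ hc u)
    (Or.inr ENNReal.ofReal_ne_top)).congr fun n => ?_
  rw [← ENNReal.ofReal_mul hc₀.le, h.levelEnergy_of_isotropic hc]

lemma domain_eq (h : IsRecursiveConstruction c₀ c) (hc₀ : 0 < c₀ 0) (hc : ∀ i j, c₀ i = c₀ j) :
    domain (energy c) = domain stdEnergy := by
  ext u
  change energy c u < ∞ ↔ stdEnergy u < ∞
  rw [h.energy_eq_stdEnergy hc₀ hc]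
  have h0 : ENNReal.ofReal (c₀ 0) ≠ 0 := (ENNReal.ofReal_pos.2 hc₀).ne'
  exact ⟨fun hlt => ENNReal.lt_top_of_mul_ne_top_right hlt.ne h0,
    fun hlt => ENNReal.mul_lt_top ENNReal.ofReal_lt_top hlt⟩

/-- The growth of the conductances in the anisotropic case. -/
lemma exists_conductance_bounds (h : IsRecursiveConstruction c₀ c) {i : Fin 3}
    (h1 : c₀ (i + 1) = c₀ (i + 2)) (h2 : c₀ (i + 1) < c₀ i) :
    ∃ C : ℝ, 0 < C ∧ ∀ n, (c n i ≤ C * 2 ^ n ∧ 2 ^ n ≤ C * c n i) ∧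
      ∀ j, j = i + 1 ∨ j = i + 2 →
        c n j ≤ C * (2 ^ n * (3 / 4) ^ n) ∧ 2 ^ n * (3 / 4) ^ n ≤ C * c n j := by
  have e := h.conductance_eq h2.le (h1 ▸ h2.le)
  have o := h.isStarOrbit i
  have hyz : (fun n => star (c n) (i + 2)) = fun n => star (c n) (i + 1) :=
    funext fun n => (e n).symm
  rw [hyz] at o
  have hcn : ∀ n, c n = star (star (c n)) := fun n => (star_star (h.pos n)).symm
  have hci : ∀ n, c n i = star (c n) i / (star (c n) (i + 1) *
      (2 * star (c n) i + star (c n) (i + 1))) := fun n => by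
    conv_lhs => rw [hcn]
    rw [star, mul_add_rotate _ i, ← e]
    congr 1
    ring
  have hcj : ∀ n j, j = i + 1 ∨ j = i + 2 → c n j = star (c n) (i + 1) / (star (c n) (i + 1) *
      (2 * star (c n) i + star (c n) (i + 1))) := fun n j hj => by
    conv_lhs => rw [hcn]
    have : star (c n) j = star (c n) (i + 1) := by
      rcases hj with rfl | rfl
      · rfl
      · exact (e n).symm
    rw [star, mul_add_rotate _ i, ← e, this]
    congr 1
    ring
  have hlt : star (c 0) (i + 1) < star (c 0) i := by
    have h0 := h.init
    subst h0
    exact lt_of_not_ge fun hle => h2.not_ge ((star_le_star (h.pos 0)).1 hle)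
  have b1 := o.bound_one hlt
  have b2 := o.bound_two hlt
  have hle := o.le_of_le hlt.le
  have px := o.pos₁
  have py := o.pos₂
  obtain ⟨X, hX⟩ : ∃ X, X = star (c 0) i := ⟨_, rfl⟩
  obtain ⟨Y, hY⟩ : ∃ Y, Y = star (c 0) (i + 1) := ⟨_, rfl⟩
  simp only [← hX, ← hY] at b1 b2 hlt
  have pX : 0 < X := hX ▸ px 0
  have pY : 0 < Y := hY ▸ py 0
  have pA : 0 < X - Y := sub_pos.2 hlt
  have pB : 0 < Y * (X / (X - Y)) ^ 2 := by positivity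
  -- The sum of the constants of `conductance_bounds₁` and `conductance_bounds₂`, so that one
  -- constant serves all three edges.
  refine ⟨3 * (Y * (X / (X - Y)) ^ 2) + 1 / Y + (3 * X + 1 / (X - Y)), by positivity, fun n => ?_⟩
  have k1 := conductance_bounds₁ (px n) (py n) (hle n) (pow_pos two_pos n) pY (b2 n).1 (b2 n).2
  have k2 := conductance_bounds₂ (px n) (py n) (hle n) (pow_pos (by norm_num) n) pA
    (b1 n).1 (b1 n).2
  rw [← hci n] at k1
  have e32 : (2 : ℝ) ^ n * (3 / 4) ^ n = (3 / 2) ^ n := by rw [← mul_pow]; norm_num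
  have enlarge : ∀ {r s t w : ℝ}, 0 < s → 0 ≤ t → r ≤ w * s → r ≤ (w + t) * s :=
    fun hs ht hr => hr.trans (mul_le_mul_of_nonneg_right (le_add_of_nonneg_right ht) hs.le)
  refine ⟨⟨enlarge (by positivity) (by positivity) k1.1,
    enlarge (h.pos n i) (by positivity) k1.2⟩, fun j hj => ?_⟩
  rw [← hcj n j hj] at k2
  rw [e32, add_comm]
  exact ⟨enlarge (by positivity) (by positivity) k2.1,
    enlarge (h.pos n j) (by positivity) k2.2⟩

lemma exists_energy_comparison (h : IsRecursiveConstruction c₀ c) {i : Fin 3}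
    (h1 : c₀ (i + 1) = c₀ (i + 2)) (h2 : c₀ (i + 1) < c₀ i) :
    ∃ C : ℝ, 0 < C ∧ ∀ u : SG → ℝ,
      energy c u ≤ ENNReal.ofReal C * (⨆ n, ENNReal.ofReal (anisotropicEnergy i n u)) ∧
      (⨆ n, ENNReal.ofReal (anisotropicEnergy i n u)) ≤ ENNReal.ofReal C * energy c u := by
  obtain ⟨C, hC, hb⟩ := h.exists_conductance_bounds h1 h2
  have hsq : ∀ (u : SG → ℝ) {n : ℕ} (ω : Fin n → Fin 3) j, 0 ≤ cellDiffSq u ω j :=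
    fun u n ω j => sq_nonneg _
  have hlev : ∀ n u, levelEnergy n (c n) u = ∑ ω : Fin n → Fin 3, (c n i * cellDiffSq u ω i +
      c n (i + 1) * cellDiffSq u ω (i + 1) + c n (i + 2) * cellDiffSq u ω (i + 2)) := fun n u => by
    refine Finset.sum_congr rfl fun ω _ => ?_
    rw [Fin.sum_univ_three]
    exact add_rotate (fun j => c n j * cellDiffSq u ω j) i
  refine ⟨C, hC, fun u => ?_⟩
  rw [h.energy_eq_iSup]
  -- Both sides are suprema over the level, so a termwise comparison at each fixed level suffices.
  constructor <;> refine iSup_le fun n => ?_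
  · refine le_trans ?_ (mul_le_mul_right (le_iSup _ n) _)
    rw [← ENNReal.ofReal_mul hC.le, hlev, anisotropicEnergy, ← mul_assoc, Finset.mul_sum]
    refine ENNReal.ofReal_le_ofReal (Finset.sum_le_sum fun ω _ => ?_)
    have k0 := mul_le_mul_of_nonneg_right (hb n).1.1 (hsq u ω i)
    have k1 := mul_le_mul_of_nonneg_right ((hb n).2 _ (Or.inl rfl)).1 (hsq u ω (i + 1))
    have k2 := mul_le_mul_of_nonneg_right ((hb n).2 _ (Or.inr rfl)).1 (hsq u ω (i + 2))
    linear_combination k0 + k1 + k2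
  · refine le_trans ?_ (mul_le_mul_right (le_iSup _ n) _)
    rw [← ENNReal.ofReal_mul hC.le, hlev, anisotropicEnergy, Finset.mul_sum, Finset.mul_sum]
    refine ENNReal.ofReal_le_ofReal (Finset.sum_le_sum fun ω _ => ?_)
    have k0 := mul_le_mul_of_nonneg_right (hb n).1.2 (hsq u ω i)
    have k1 := mul_le_mul_of_nonneg_right ((hb n).2 _ (Or.inl rfl)).2 (hsq u ω (i + 1))
    have k2 := mul_le_mul_of_nonneg_right ((hb n).2 _ (Or.inr rfl)).2 (hsq u ω (i + 2))
    linear_combination k0 + k1 + k2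

end IsRecursiveConstruction

end

end Gasket

theorem corollary2p4 (c₀ : Fin 3 → ℝ) (hc₀ : ∀ i, 0 < c₀ i) :
    -- a recursive construction exists in precisely two cases, and it is then unique
    ((∃ c, Gasket.IsRecursiveConstruction c₀ c) ↔
      (∀ i j, c₀ i = c₀ j) ∨ ∃ i, c₀ (i + 1) = c₀ (i + 2) ∧ c₀ (i + 1) < c₀ i) ∧
    (∀ c c', Gasket.IsRecursiveConstruction c₀ c → Gasket.IsRecursiveConstruction c₀ c' →
      c = c') ∧
    ∀ c, Gasket.IsRecursiveConstruction c₀ c →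
      -- the limit that defines the energy exists
      (∀ u : Gasket.SG → ℝ, Tendsto (fun n => ENNReal.ofReal (Gasket.levelEnergy n (c n) u))
        atTop (𝓝 (Gasket.energy c u))) ∧
      -- first case: the standard energy form
      ((∀ i j, c₀ i = c₀ j) →
        (∀ u : Gasket.SG → ℝ, Tendsto (fun n => ENNReal.ofReal (Gasket.stdLevelEnergy n u))
            atTop (𝓝 (Gasket.stdEnergy u)) ∧
          Gasket.energy c u = ENNReal.ofReal (c₀ 0) * Gasket.stdEnergy u) ∧
        Gasket.domain (Gasket.energy c) = Gasket.domain Gasket.stdEnergy) ∧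
      -- second case: the anisotropic energy with two scaling exponents
      (∀ i, c₀ (i + 1) = c₀ (i + 2) → c₀ (i + 1) < c₀ i →
        ∃ C : ℝ, 0 < C ∧ ∀ u : Gasket.SG → ℝ,
          Gasket.energy c u ≤
            ENNReal.ofReal C * (⨆ n, ENNReal.ofReal (Gasket.anisotropicEnergy i n u)) ∧
          (⨆ n, ENNReal.ofReal (Gasket.anisotropicEnergy i n u)) ≤
            ENNReal.ofReal C * Gasket.energy c u) := by
  refine ⟨⟨fun ⟨c, hc⟩ => hc.cases, ?_⟩, fun c c' hc hc' => hc.unique hc', fun c hc =>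
    ⟨hc.tendsto_energy, fun h => ⟨fun u => ⟨hc.tendsto_stdEnergy (hc₀ 0) h u,
      hc.energy_eq_stdEnergy (hc₀ 0) h u⟩, hc.domain_eq (hc₀ 0) h⟩,
      fun i h1 h2 => hc.exists_energy_comparison h1 h2⟩⟩
  rintro (h | ⟨i, h1, h2⟩)
  · exact Gasket.exists_isRecursiveConstruction hc₀ (i := 0) (h _ _) (h _ _).le
  · exact Gasket.exists_isRecursiveConstruction hc₀ h1 h2.le
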